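/- Let $(W_t)_{t\ge 0}$ be a standard Brownian motion, let $\tau>0$ be a constant, and for each $n$ let $\epsilon_{1,n},\dots,\epsilon_{n,n}$ be i.i.d. real random variables, independent of $W$, whose common law $\nu$ is centered with variance $1$ and finite fourth moment. For a function $\sigma>0$ on $[0,1]$ consider the observations $$\text{(1)}\quad Y_{i,n}=\int_0^{i/n}\sigma(s)\,dW_s+\tau\,\epsilon_{i,n},\qquad\qquad \text{(2)}\quad Y_{i,n}=\sigma(i/n)\,W_{i/n}+\tau\,\epsilon_{i,n},\qquad i=1,\dots,n.$$ For an integer $\alpha\ge 1$, $Q>0$ and $0<l<u<\infty$ let $\Theta^b_s(\alpha,Q)$ be the set of functions $f\in L^2[0,1]$ with $l\le f\le u$ that have a cosine expansion $f(x)=\theta_0+2\sum_{i\ge1}\theta_i\cos(i\pi x)$, $x\in[0,1]$, with $\sum_{i\ge1}i^{2\alpha}\theta_i^2\le Q$ (the series then converges absolutely). Let $\alpha\in\mathbb N$, $\alpha\ge1$, $Q>0$, $0<l<u<\infty$ and $\tau_0>0$. Then there is a constant $C>0$, depending only on $\alpha,Q,l,u,\tau_0$, such that for every constant $\tau\ge\tau_0$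 (which may be known to the statistician), for every set $\mathcal L$ of centered laws with variance $1$ and finite fourth moment that contains the standard normal law $N(0,1)$ (for instance the set of all such laws, or $\{N(0,1)\}$), and in each of the models (1) and (2), $$\liminf_{n\to\infty}\ \inf_{\hat\sigma_n^2}\ \sup_{\sigma^2\in\Theta^b_s(\alpha,Q),\ \nu\in\mathcal L}\ \operatorname{E}\Big(n^{\frac{\alpha}{2\alpha+1}}\,\big\|\hat\sigma_n^2-\sigma^2\big\|_{L^2[0,1]}^2\Big)\ \ge\ C,$$ where the infimum is over all (measurable) estimators $\hat\sigma_n^2$ based on $Y_{1,n},\dots,Y_{n,n}$. -/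

import Mathlib

open MeasureTheory ProbabilityTheory Filter Topology Set
open scoped ENNReal NNReal

namespace VolatilityLowerBound

/-! ### Function classes -/

/-- The Sobolev s-ellipsoid with integer smoothness index `α` and radius `C`: functions on `[0,1]`
with a cosine expansion `f x = θ₀ + 2 ∑_{i ≥ 1} θᵢ cos (i π x)` with `∑_{i ≥ 1} i ^ (2 α) θᵢ² ≤ C`.
For `α ≥ 1` the last condition makes the cosine series absolutely convergent, and `f` is the
(continuous) representative given by its sum at every point of `[0,1]`. Values of `f` outside
`[0,1]` are irrelevant. -/
def sobolevSEllipsoid (α : ℕ) (C : ℝ) : Set (ℝ → ℝ) :=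
  {f | MemLp f 2 (volume.restrict (Icc (0 : ℝ) 1)) ∧
    ∃ θ : ℕ → ℝ,
      (∀ x ∈ Icc (0 : ℝ) 1,
        HasSum (fun i : ℕ => 2 * (θ (i + 1) * Real.cos (((i + 1 : ℕ) : ℝ) * Real.pi * x)))
          (f x - θ 0)) ∧
      Summable (fun i : ℕ => ((i + 1 : ℕ) : ℝ) ^ (2 * α) * θ (i + 1) ^ 2) ∧
      ∑' i : ℕ, ((i + 1 : ℕ) : ℝ) ^ (2 * α) * θ (i + 1) ^ 2 ≤ C}

/-- The uniformly bounded Sobolev s-ellipsoid: the `f` in the s-ellipsoid with `l ≤ f ≤ u`. -/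
def boundedSobolevSEllipsoid (α : ℕ) (C l u : ℝ) : Set (ℝ → ℝ) :=
  {f | f ∈ sobolevSEllipsoid α C ∧ ∀ x ∈ Icc (0 : ℝ) 1, l ≤ f x ∧ f x ≤ u}

/-! ### The Wiener integral -/

section Wiener

variable {Ω : Type*} [MeasurableSpace Ω]

/-- The step function `∑_b c_b 𝟙_{(0, b]}` on `(0, ∞)` with coefficients `s b = c_b`. Since
`𝟙_{(a, b]} = 𝟙_{(0, b]} - 𝟙_{(0, a]}`, every left-open right-closed step function has this form. -/
noncomputable def stepFun (s : ℝ≥0 →₀ ℝ) (x : ℝ) : ℝ :=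
  s.sum fun b c => c * (Ioc (0 : ℝ) b).indicator (fun _ => (1 : ℝ)) x

/-- The integral `∑_b c_b (W_b - W_0)` of the step function `∑_b c_b 𝟙_{(0, b]}` against `W`. -/
noncomputable def stepIntegral (W : ℝ≥0 → Ω → ℝ) (s : ℝ≥0 →₀ ℝ) (ω : Ω) : ℝ :=
  s.sum fun b c => c * (W b ω - W 0 ω)

/-- `I` is the Wiener integral `∫_0^∞ h dW`: the limit in `L²(P)` of the integrals of step
functions that converge to `h` in `L²(0, ∞)`. -/
def IsWienerIntegral (W : ℝ≥0 → Ω → ℝ) (P : Measure Ω) (h : ℝ → ℝ) (I : Ω → ℝ) : Prop :=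
  MemLp I 2 P ∧
    ∃ s : ℕ → (ℝ≥0 →₀ ℝ),
      Tendsto (fun k => eLpNorm (fun x => stepFun (s k) x - h x) 2 (volume.restrict (Ioi (0 : ℝ))))
        atTop (𝓝 0) ∧
      Tendsto (fun k => eLpNorm (fun ω => stepIntegral W (s k) ω - I ω) 2 P) atTop (𝓝 0)

open scoped Classical in
/-- The Wiener integral `∫_0^t g dW` of a deterministic function `g`. It exists whenever `W` is a
Brownian motion and `g` is square integrable on `(0, t]`, see `exists_isWienerIntegral`. -/
noncomputable def wienerIntegral (W : ℝ≥0 → Ω → ℝ) (P : Measure Ω) (t : ℝ) (g : ℝ → ℝ) : Ω → ℝ :=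
  if h : ∃ I, IsWienerIntegral W P ((Ioc (0 : ℝ) t).indicator g) I then h.choose else 0

section Existence

variable {W : ℝ≥0 → Ω → ℝ} {P : Measure Ω}

lemma memLp_incr (hW : IsPreBrownianReal W P) (b : ℝ≥0) :
    MemLp (fun ω => W b ω - W 0 ω) 2 P :=
  (hW.isGaussianProcess.hasGaussianLaw_eval b).memLp_two.sub
    (hW.isGaussianProcess.hasGaussianLaw_eval 0).memLp_two

lemma ioc_ne_top (b : ℝ≥0) :
    (volume.restrict (Ioi (0 : ℝ))) (Ioc (0 : ℝ) b) ≠ ∞ :=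
  ((Measure.restrict_apply_le _ _).trans_lt (by simp)).ne

noncomputable def stepLp : (ℝ≥0 →₀ ℝ) →ₗ[ℝ] Lp ℝ 2 (volume.restrict (Ioi (0 : ℝ))) :=
  Finsupp.linearCombination ℝ fun b =>
    indicatorConstLp 2 (measurableSet_Ioc (a := (0 : ℝ)) (b := b)) (ioc_ne_top b) (1 : ℝ)

noncomputable def stepIntLp (hW : IsPreBrownianReal W P) : (ℝ≥0 →₀ ℝ) →ₗ[ℝ] Lp ℝ 2 P :=
  Finsupp.linearCombination ℝ fun b => (memLp_incr hW b).toLp _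

lemma stepLp_coe (s : ℝ≥0 →₀ ℝ) :
    (stepLp s : ℝ → ℝ) =ᵐ[volume.restrict (Ioi (0 : ℝ))] stepFun s := by
  induction s using Finsupp.induction_linear with
  | zero =>
    simp only [map_zero]
    filter_upwards [Lp.coeFn_zero ℝ 2 (volume.restrict (Ioi (0 : ℝ)))] with x hx
    rw [hx]; simp [stepFun]
  | add f g hf hg =>
    rw [map_add]
    filter_upwards [Lp.coeFn_add (stepLp f) (stepLp g), hf, hg] with x hx h1 h2
    rw [hx, Pi.add_apply, h1, h2, stepFun, stepFun, stepFun, Finsupp.sum_add_index'] <;>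
      simp [add_mul]
  | single b c =>
    have : stepLp (Finsupp.single b c) = c • indicatorConstLp 2
      (measurableSet_Ioc (a := (0 : ℝ)) (b := b)) (ioc_ne_top b) (1 : ℝ) := by
      simp [stepLp]
    rw [this]
    filter_upwards [Lp.coeFn_smul c (indicatorConstLp 2
      (measurableSet_Ioc (a := (0 : ℝ)) (b := b)) (ioc_ne_top b) (1 : ℝ)),
      indicatorConstLp_coeFn (p := 2) (hs := measurableSet_Ioc (a := (0 : ℝ)) (b := b))
      (hμs := ioc_ne_top b) (c := (1 : ℝ))] with x h1 h2
    rw [h1, Pi.smul_apply, h2]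
    simp [stepFun]

lemma stepIntLp_coe (hW : IsPreBrownianReal W P) (s : ℝ≥0 →₀ ℝ) :
    (stepIntLp hW s : Ω → ℝ) =ᵐ[P] stepIntegral W s := by
  induction s using Finsupp.induction_linear with
  | zero =>
    simp only [map_zero]
    filter_upwards [Lp.coeFn_zero ℝ 2 P] with x hx
    rw [hx]; simp [stepIntegral]
  | add f g hf hg =>
    rw [map_add]
    filter_upwards [Lp.coeFn_add (stepIntLp hW f) (stepIntLp hW g), hf, hg] with x hx h1 h2
    rw [hx, Pi.add_apply, h1, h2, stepIntegral, stepIntegral, stepIntegral,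
      Finsupp.sum_add_index'] <;> simp [add_mul]
  | single b c =>
    have : stepIntLp hW (Finsupp.single b c) = c • (memLp_incr hW b).toLp _ := by
      simp [stepIntLp]
    rw [this]
    filter_upwards [Lp.coeFn_smul c ((memLp_incr hW b).toLp _),
      (memLp_incr hW b).coeFn_toLp] with x h1 h2
    rw [h1, Pi.smul_apply, h2]
    simp [stepIntegral]

lemma inner_incr (hW : IsPreBrownianReal W P) (a b : ℝ≥0) :
    inner ℝ ((memLp_incr hW a).toLp _) ((memLp_incr hW b).toLp _) = ((min a b : ℝ≥0) : ℝ) := by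
  have := hW.isGaussianProcess.isProbabilityMeasure
  rw [L2.inner_def]
  have h0 := hW.eval_zero_ae_eq_zero
  have h1 : (∫ ω, inner ℝ ((memLp_incr hW a).toLp _ ω) ((memLp_incr hW b).toLp _ ω) ∂P)
      = ∫ ω, (W a * W b) ω ∂P := by
    apply integral_congr_ae
    filter_upwards [h0, (memLp_incr hW a).coeFn_toLp, (memLp_incr hW b).coeFn_toLp]
      with ω h0 h1 h2
    rw [h1, h2, h0]
    simp [mul_comm]
  rw [h1]
  have h2 := hW.covariance_eval a b
  rw [covariance_eq_sub (hW.isGaussianProcess.hasGaussianLaw_eval a).memLp_two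
    (hW.isGaussianProcess.hasGaussianLaw_eval b).memLp_two, hW.integral_eval a] at h2
  simpa using h2

lemma inner_ind (a b : ℝ≥0) :
    inner ℝ (indicatorConstLp 2 (measurableSet_Ioc (a := (0 : ℝ)) (b := a)) (ioc_ne_top a) (1 : ℝ))
      (indicatorConstLp 2 (measurableSet_Ioc (a := (0 : ℝ)) (b := b)) (ioc_ne_top b) (1 : ℝ))
      = ((min a b : ℝ≥0) : ℝ) := by
  rw [L2.real_inner_indicatorConstLp_one_indicatorConstLp_one measurableSet_Ioc measurableSet_Ioc
    (ioc_ne_top a) (ioc_ne_top b), Ioc_inter_Ioc]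
  rw [measureReal_restrict_apply measurableSet_Ioc,
    inter_eq_left.2 (fun x hx => by simpa using hx.1)]
  simp

lemma isometry_step (hW : IsPreBrownianReal W P) (s : ℝ≥0 →₀ ℝ) :
    ‖stepIntLp hW s‖ = ‖stepLp s‖ := by
  have : inner ℝ (stepIntLp hW s) (stepIntLp hW s) = inner ℝ (stepLp s) (stepLp s) := by
    simp only [stepIntLp, stepLp, Finsupp.linearCombination_apply, Finsupp.sum, sum_inner,
      inner_sum, inner_smul_left, inner_smul_right, inner_ind]
    refine Finset.sum_congr rfl fun x _ => ?_
    congr 1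
    exact Finset.sum_congr rfl fun y _ => by rw [inner_incr hW y x]
  rw [real_inner_self_eq_norm_sq, real_inner_self_eq_norm_sq] at this
  exact (pow_left_inj₀ (norm_nonneg _) (norm_nonneg _) two_ne_zero).1 this

lemma dense_step : Dense (range stepLp) := by
  have h : (LinearMap.range stepLp).topologicalClosure = ⊤ := by
    rw [Submodule.topologicalClosure_eq_top_iff, Submodule.eq_bot_iff]
    intro f hf
    have key : ∀ b : ℝ≥0, ∫ x in Ioc (0 : ℝ) b, (Ioi (0 : ℝ)).indicator f x = 0 := by
      intro b
      have h1 := hf (stepLp (Finsupp.single b 1)) ⟨_, rfl⟩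
      have h2 : stepLp (Finsupp.single b 1) = indicatorConstLp 2
          (measurableSet_Ioc (a := (0 : ℝ)) (b := b)) (ioc_ne_top b) (1 : ℝ) := by
        simp [stepLp]
      rw [h2, L2.inner_indicatorConstLp_one, Measure.restrict_restrict measurableSet_Ioc,
        inter_eq_left.2 (fun x hx => by simpa using hx.1)] at h1
      refine Eq.trans ?_ h1
      refine setIntegral_congr_fun measurableSet_Ioc fun x hx => ?_
      exact indicator_of_mem (show x ∈ Ioi (0 : ℝ) from hx.1) _
    have hloc : LocallyIntegrable ((Ioi (0 : ℝ)).indicator f) volume := by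
      have hm : MemLp ((Ioi (0 : ℝ)).indicator f) 2 volume :=
        (memLp_indicator_iff_restrict measurableSet_Ioi).2 (Lp.memLp f)
      exact hm.locallyIntegrable (by norm_num)
    have hz : ∀ x : ℝ, ∫ y in (0 : ℝ)..x, (Ioi (0 : ℝ)).indicator f y = 0 := by
      intro x
      rcases le_total 0 x with hx | hx
      · rw [intervalIntegral.integral_of_le hx]
        exact key ⟨x, hx⟩
      · rw [intervalIntegral.integral_of_ge hx, neg_eq_zero]
        refine setIntegral_eq_zero_of_forall_eq_zero fun y hy => ?_
        exact indicator_of_notMem (by simpa using hy.2) _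
    apply Lp.ext
    have h3 : ∀ᵐ x ∂(volume : Measure ℝ), (Ioi (0 : ℝ)).indicator f x = 0 := by
      filter_upwards [LocallyIntegrable.ae_hasDerivAt_integral hloc] with x hx
      have := hx 0
      simp only [hz] at this
      exact this.unique (hasDerivAt_const x 0)
    filter_upwards [ae_restrict_of_ae h3, ae_restrict_mem measurableSet_Ioi,
      Lp.coeFn_zero ℝ 2 (volume.restrict (Ioi (0 : ℝ)))] with x h4 h5 h6
    rw [h6, ← indicator_of_mem h5 f, h4]; rfl
  have := (Submodule.dense_iff_topologicalClosure_eq_top).2 h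
  rwa [LinearMap.coe_range] at this

/-- Existence of the Wiener integral of a square integrable function. -/
theorem exists_isWienerIntegral (hW : IsPreBrownianReal W P) {h : ℝ → ℝ}
    (hh : MemLp h 2 (volume.restrict (Ioi (0 : ℝ)))) : ∃ I, IsWienerIntegral W P h I := by
  obtain ⟨y, hy, hlim⟩ := mem_closure_iff_seq_limit.1 (dense_step (hh.toLp h))
  choose s hs using hy
  have hc : CauchySeq fun k => stepIntLp hW (s k) := by
    have hc' := hlim.cauchySeq
    rw [Metric.cauchySeq_iff] at hc' ⊢
    intro ε hε
    obtain ⟨N, hN⟩ := hc' ε hε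
    refine ⟨N, fun m hm k hk => ?_⟩
    rw [dist_eq_norm, ← map_sub, isometry_step, map_sub, hs, hs, ← dist_eq_norm]
    exact hN m hm k hk
  obtain ⟨I, hI⟩ := cauchySeq_tendsto_of_complete hc
  refine ⟨I, Lp.memLp I, s, ?_, ?_⟩
  · rw [Lp.tendsto_Lp_iff_tendsto_eLpNorm] at hlim
    refine hlim.congr fun k => eLpNorm_congr_ae ?_
    rw [← hs k]
    filter_upwards [stepLp_coe (s k)] with x hx
    simp [hx]
  · rw [Lp.tendsto_Lp_iff_tendsto_eLpNorm'] at hI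
    refine hI.congr fun k => eLpNorm_congr_ae ?_
    filter_upwards [stepIntLp_coe hW (s k)] with x hx
    simp [hx]

end Existence

end Wiener

/-! ### The two observation models and the risk -/

section Models

variable {Ω : Type*} [MeasurableSpace Ω]

/-- The design point `i / n`, where `i = 1, …, n` is indexed by `Fin n` (so `i : Fin n` stands for
the observation number `i + 1`). -/
noncomputable def designPoint (n : ℕ) (i : Fin n) : ℝ≥0 := ((i : ℕ) + 1 : ℝ≥0) / (n : ℝ≥0)

/-- The signal `∫_0^{i/n} σ dW`, `i = 1, …, n`, of the first model, where `σ = √σsq`. -/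
noncomputable def signalTime (W : ℝ≥0 → Ω → ℝ) (P : Measure Ω) (σsq : ℝ → ℝ) (n : ℕ)
    (i : Fin n) : Ω → ℝ :=
  wienerIntegral W P (designPoint n i) fun s => √(σsq s)

/-- The signal `σ(i/n) W_{i/n}`, `i = 1, …, n`, of the second model, where `σ = √σsq`. -/
noncomputable def signalSpace (W : ℝ≥0 → Ω → ℝ) (σsq : ℝ → ℝ) (n : ℕ) (i : Fin n) : Ω → ℝ :=
  fun ω => √(σsq (designPoint n i)) * W (designPoint n i) ω

/-- The observations `Y_i = X_i + τ(i/n) ε_i`, `i = 1, …, n`, as random variables on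
`Ω × ℝⁿ`, the second factor carrying the noise `ε = (ε_1, …, ε_n)`. -/
noncomputable def observation {n : ℕ} (X : Fin n → Ω → ℝ) (τ : ℝ → ℝ) (p : Ω × (Fin n → ℝ)) :
    Fin n → ℝ :=
  fun i => X i p.1 + τ (designPoint n i) * p.2 i

/-- Admissible laws of the microstructure noise: centered, variance one, finite fourth moment. -/
def IsNoiseLaw (ν : Measure ℝ) : Prop :=
  IsProbabilityMeasure ν ∧ ∫ x, x ∂ν = 0 ∧ ∫ x, x ^ 2 ∂ν = 1 ∧ Integrable (fun x => x ^ 4) ν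

/-- The mean integrated squared error `E ‖T(Y) - σsq‖²` in `L²[0,1]` of the estimator `T`, when
the noise variables are i.i.d. with law `ν` and independent of the process that drives `X`.
An estimator maps the data `y ∈ ℝⁿ` to the function `T y` on `[0,1]`. -/
noncomputable def mise {n : ℕ} (P : Measure Ω) (X : Fin n → Ω → ℝ) (τ : ℝ → ℝ) (ν : Measure ℝ)
    (σsq : ℝ → ℝ) (T : (Fin n → ℝ) → ℝ → ℝ) : ℝ≥0∞ :=
  ∫⁻ p, (∫⁻ t in Icc (0 : ℝ) 1, ‖T (observation X τ p) t - σsq t‖ₑ ^ 2)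
    ∂(P.prod (Measure.pi fun _ : Fin n => ν))

/-- The normalized minimax risk
`inf_T sup_{σ² ∈ Θ, ν ∈ 𝓛} E (n ^ (α / (2 α + 1)) ‖T(Y) - σ²‖²)`. Here `X σ²` is the signal that
belongs to `σ²`, and `T` runs over all (jointly measurable) estimators based on `n` observations. -/
noncomputable def minimaxRisk (P : Measure Ω) (α n : ℕ) (X : (ℝ → ℝ) → Fin n → Ω → ℝ) (τ : ℝ → ℝ)
    (Θ : Set (ℝ → ℝ)) (𝓛 : Set (Measure ℝ)) : ℝ≥0∞ :=
  ⨅ (T : (Fin n → ℝ) → ℝ → ℝ) (_ : Measurable (Function.uncurry T)),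
    ⨆ (σsq ∈ Θ) (ν ∈ 𝓛),
      ENNReal.ofReal ((n : ℝ) ^ ((α : ℝ) / (2 * (α : ℝ) + 1))) * mise P (X σsq) τ ν σsq T

end Models

end VolatilityLowerBound

/-! The bound is Assouad's lemma on a hypercube of trigonometric perturbations of a constant
volatility, with standard normal noise, so that all laws involved are centered Gaussian. The
vertices are c + 2 ∑ γ bᵢ cos(iπx), 1 ≤ i ≤ m, with b ∈ {0,1}^m, c = (l + u)/2, γ² = A² m^{-(2α+1)}
and m of order n^{1/(2(2α+1))}. Then γ² m^{2α+1} = A² ≤ Q is the ellipsoid condition, and α ≥ 1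
gives γm ≤ A, which keeps the functions between l and u. Each bit contributes 2γ² to the squared L²
distance. If no single bit can be tested reliably, the risk is at least γ²m/8 (`assouad`,
`le_minimaxRisk`), and this is of order m^{-2α}, that is n^{-α/(2α+1)}.

It remains to compare neighbouring vertices. In both models the covariance matrix is K = U diag(d)
Uᵀ + τ² with U = diag(D) S and S the partial sum matrix: D = 1 and d the cell integrals of σ² in
model (1), D = σ(i/n) and d = 1/n in model (2). Covariances K and K + B give laws at bounded
chi-square distance as soon as tr((K⁻¹B)²) ≤ 3/4 (`HasGaussianCharFun.sq_le`). Flipping a bit yields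
B = U(diag β + E)Uᵀ with β of order γ/n, so the trace is controlled by G = UᵀK⁻¹U.

The crux is that the squared Hilbert-Schmidt norm of G is of order n^{5/2} (`sum_sandwich_sq_le`),
whereas its operator norm, of order n, would only give n³. The gain comes from a discrete Agmon
inequality (`agmon_partialSum`) and reflects that the noise leaves only about √n informative
frequencies. The diagonal part of the trace is therefore of order γ²√n ≤ A². In model (1) E = 0. In
model (2) the multiplier does not commute with partial sums; summation by parts produces an E of
Hilbert-Schmidt norm of order A/n, for which the operator norm of G suffices. A small A, independent
of n and of τ ≥ τ₀, finishes the proof. -/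

namespace VolatilityLowerBound

/-! ### Likelihood ratios of centered Gaussian laws -/

section GaussianRatio

/-- The likelihood ratio of `N(0, v)` with respect to `N(0, 1)`. -/
noncomputable def gaussianRatio (v : ℝ≥0) (x : ℝ) : ℝ≥0∞ :=
  ENNReal.ofReal (gaussianPDFReal 0 v x / gaussianPDFReal 0 1 x)

lemma measurable_gaussianRatio (v : ℝ≥0) : Measurable (gaussianRatio v) :=
  ((measurable_gaussianPDFReal 0 v).div (measurable_gaussianPDFReal 0 1)).ennreal_ofReal

lemma gaussianReal_eq_withDensity_gaussianRatio {v : ℝ≥0} (hv : v ≠ 0) :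
    gaussianReal 0 v = (gaussianReal 0 1).withDensity (gaussianRatio v) := by
  rw [gaussianReal_of_var_ne_zero _ hv, gaussianReal_of_var_ne_zero _ one_ne_zero,
    ← withDensity_mul _ (measurable_gaussianPDF 0 1) (measurable_gaussianRatio v)]
  congr 1
  ext x
  have h1 := gaussianPDFReal_pos 0 1 x one_ne_zero
  simp only [Pi.mul_apply, gaussianPDF, gaussianRatio]
  rw [← ENNReal.ofReal_mul h1.le, mul_div_cancel₀ _ h1.ne']

/-- The integrand φ_v²/φ_1 is a multiple of the centered Gaussian density with variance w = v/(2 -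
v), because 2/v - 1 = 1/w. Finiteness requires v < 2. -/
lemma lintegral_gaussianRatio_sq {v : ℝ≥0} (hv : 0 < v) (hv2 : v < 2) :
    ∫⁻ x, gaussianRatio v x ^ 2 ∂(gaussianReal 0 1)
      = ENNReal.ofReal (√(v * (2 - v)))⁻¹ := by
  have h0 : (0 : ℝ) < v := hv
  have h2 : (0 : ℝ) < 2 - v := by
    have : (v : ℝ) < 2 := by exact_mod_cast hv2
    linarith
  set w : ℝ≥0 := Real.toNNReal (v / (2 - v))
  have hw : (w : ℝ) = v / (2 - v) := Real.coe_toNNReal _ (by positivity)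
  have hwpos : (0 : ℝ) < w := by rw [hw]; positivity
  have hw0 : w ≠ 0 := fun h => by rw [h] at hwpos; simp at hwpos
  rw [gaussianReal_of_var_ne_zero _ one_ne_zero,
    lintegral_withDensity_eq_lintegral_mul _ (measurable_gaussianPDF 0 1)
      ((measurable_gaussianRatio v).pow_const 2)]
  have key : ∀ x, (gaussianPDF 0 1 * fun x => gaussianRatio v x ^ 2) x
      = ENNReal.ofReal (√(v * (2 - v)))⁻¹ * gaussianPDF 0 w x := by
    intro x
    have h1 := gaussianPDFReal_pos 0 1 x one_ne_zero
    have h3 := gaussianPDFReal_pos 0 v x hv.ne'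
    simp only [Pi.mul_apply, gaussianPDF, gaussianRatio]
    rw [← ENNReal.ofReal_pow (by positivity), ← ENNReal.ofReal_mul h1.le,
      ← ENNReal.ofReal_mul (by positivity)]
    congr 1
    have : gaussianPDFReal 0 1 x * (gaussianPDFReal 0 v x / gaussianPDFReal 0 1 x) ^ 2
        = gaussianPDFReal 0 v x ^ 2 / gaussianPDFReal 0 1 x := by
      field_simp
    rw [this]
    rw [div_eq_iff h1.ne']
    simp only [gaussianPDFReal, sub_zero, NNReal.coe_one, mul_one]
    have e : Real.exp (-x ^ 2 / (2 * v)) ^ 2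
        = Real.exp (-x ^ 2 / (2 * w)) * Real.exp (-x ^ 2 / 2) := by
      rw [← Real.exp_nat_mul, ← Real.exp_add]
      congr 1
      rw [hw]
      push_cast
      field_simp
      ring
    rw [mul_pow, e]
    have s : (√(2 * Real.pi * v))⁻¹ ^ 2
        = (√(v * (2 - v)))⁻¹ * (√(2 * Real.pi * w))⁻¹ * (√(2 * Real.pi))⁻¹ := by
      rw [← mul_inv, ← mul_inv, inv_pow, Real.sq_sqrt (by positivity),
        ← Real.sqrt_mul (by positivity), ← Real.sqrt_mul (by positivity)]
      congr 1
      symm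
      rw [Real.sqrt_eq_iff_mul_self_eq (by positivity) (by positivity)]
      rw [hw]
      field_simp
    rw [s]
    ring
  simp_rw [key]
  rw [lintegral_const_mul _ (measurable_gaussianPDF 0 w), lintegral_gaussianPDF_eq_one 0 hw0,
    mul_one]

lemma pi_withDensity {ι : Type*} [Fintype ι] {X : ι → Type*} [∀ i, MeasurableSpace (X i)]
    (μ : ∀ i, Measure (X i)) [∀ i, IsProbabilityMeasure (μ i)] (f : ∀ i, X i → ℝ≥0∞)
    (hf : ∀ i, Measurable (f i)) [∀ i, SigmaFinite ((μ i).withDensity (f i))] :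
    Measure.pi (fun i => (μ i).withDensity (f i))
      = (Measure.pi μ).withDensity fun x => ∏ i, f i (x i) := by
  refine Measure.pi_eq fun s hs => ?_
  rw [withDensity_apply _ (MeasurableSet.univ_pi hs),
    ← lintegral_indicator (MeasurableSet.univ_pi hs)]
  have h1 : ∀ x, (Set.pi univ s).indicator (fun x => ∏ i, f i (x i)) x
      = ∏ i, (s i).indicator (f i) (x i) := by
    intro x
    by_cases hx : x ∈ Set.pi univ s
    · rw [indicator_of_mem hx]
      exact Finset.prod_congr rfl fun i _ => (indicator_of_mem (hx i (mem_univ i)) _).symm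
    · rw [indicator_of_notMem hx]
      simp only [mem_univ_pi, not_forall] at hx
      obtain ⟨i, hi⟩ := hx
      exact (Finset.prod_eq_zero (Finset.mem_univ i) (indicator_of_notMem hi _)).symm
  simp_rw [h1]
  have hind : iIndepFun (fun i (x : ∀ i, X i) => (s i).indicator (f i) (x i)) (Measure.pi μ) :=
    iIndepFun_pi fun i => ((hf i).indicator (hs i)).aemeasurable
  rw [lintegral_prod_eq_prod_lintegral_of_indepFun Finset.univ _ hind
    (fun i => ((hf i).indicator (hs i)).comp (measurable_pi_apply i))]
  refine Finset.prod_congr rfl fun i _ => ?_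
  rw [withDensity_apply _ (hs i), ← lintegral_indicator (hs i)]
  exact (measurePreserving_eval μ i).lintegral_comp ((hf i).indicator (hs i))

lemma one_sub_sum_le_prod_one_sub {ι : Type*} (s : Finset ι) (x : ι → ℝ) (h0 : ∀ i ∈ s, 0 ≤ x i)
    (h1 : ∀ i ∈ s, x i ≤ 1) : 1 - ∑ i ∈ s, x i ≤ ∏ i ∈ s, (1 - x i) := by
  induction s using Finset.cons_induction with
  | empty => simp
  | cons a s ha ih =>
    rw [Finset.sum_cons, Finset.prod_cons]
    have h2 := ih (fun i hi => h0 i (Finset.mem_cons_of_mem hi))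
      (fun i hi => h1 i (Finset.mem_cons_of_mem hi))
    have h3 := h0 a (Finset.mem_cons_self a s)
    have h4 := h1 a (Finset.mem_cons_self a s)
    have h5 : 0 ≤ ∑ i ∈ s, x i := Finset.sum_nonneg fun i hi => h0 i (Finset.mem_cons_of_mem hi)
    nlinarith [mul_le_mul_of_nonneg_left h2 (sub_nonneg.2 h4), mul_nonneg h3 h5]

lemma lintegral_mul_sq_le {X : Type*} [MeasurableSpace X] {μ : Measure X} {f g : X → ℝ≥0∞}
    (hf : AEMeasurable f μ) (hg : AEMeasurable g μ) :
    (∫⁻ x, f x * g x ∂μ) ^ 2 ≤ (∫⁻ x, f x ^ 2 ∂μ) * ∫⁻ x, g x ^ 2 ∂μ := by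
  have h := ENNReal.lintegral_mul_le_Lp_mul_Lq μ Real.HolderConjugate.two_two hf hg
  refine (pow_le_pow_left' h 2).trans (le_of_eq ?_)
  rw [mul_pow, ← ENNReal.rpow_natCast, ← ENNReal.rpow_mul, ← ENNReal.rpow_natCast,
    ← ENNReal.rpow_mul]
  norm_num

/-- Two product Gaussian laws whose variances are close in the Euclidean sense. -/
lemma pi_gaussianReal_sq_le {ι : Type*} [Fintype ι] (v : ι → ℝ≥0)
    (hv : ∑ i, ((v i : ℝ) - 1) ^ 2 ≤ 3 / 4) {S : Set (ι → ℝ)} (hS : MeasurableSet S) :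
    (Measure.pi fun i => gaussianReal 0 (v i)) S ^ 2
      ≤ 2 * (Measure.pi fun _ : ι => gaussianReal 0 1) S := by
  have hi : ∀ i, ((v i : ℝ) - 1) ^ 2 ≤ 3 / 4 := fun i =>
    (Finset.single_le_sum (f := fun i => ((v i : ℝ) - 1) ^ 2) (fun _ _ => sq_nonneg _)
      (Finset.mem_univ i)).trans hv
  have hpos : ∀ i, 0 < v i := fun i => by
    have : (0 : ℝ) < v i := by nlinarith [hi i, (v i).2]
    exact_mod_cast this
  have hlt : ∀ i, v i < 2 := fun i => by
    have : (v i : ℝ) < 2 := by nlinarith [hi i]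
    exact_mod_cast this
  have hd : (Measure.pi fun i => gaussianReal 0 (v i))
      = (Measure.pi fun _ : ι => gaussianReal 0 1).withDensity
        fun x => ∏ i, gaussianRatio (v i) (x i) := by
    have hs : ∀ i, gaussianReal 0 (v i) = (gaussianReal 0 1).withDensity (gaussianRatio (v i)) :=
      fun i => gaussianReal_eq_withDensity_gaussianRatio (hpos i).ne'
    have : ∀ i, SigmaFinite ((gaussianReal 0 1).withDensity (gaussianRatio (v i))) := fun i => by
      rw [← hs i]; infer_instance
    rw [← pi_withDensity _ _ fun i => measurable_gaussianRatio (v i)]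
    simp_rw [← hs]
  set μ := Measure.pi fun _ : ι => gaussianReal 0 1 with hμ
  set f : (ι → ℝ) → ℝ≥0∞ := fun x => ∏ i, gaussianRatio (v i) (x i) with hf
  have hfm : Measurable f := Finset.measurable_prod _ fun i _ =>
    (measurable_gaussianRatio (v i)).comp (measurable_pi_apply i)
  have hchi : ∫⁻ x, f x ^ 2 ∂μ ≤ 2 := by
    have hind : iIndepFun (fun i (x : ι → ℝ) => gaussianRatio (v i) (x i) ^ 2) μ :=
      iIndepFun_pi (X := fun i x => gaussianRatio (v i) x ^ 2)
        fun i => ((measurable_gaussianRatio (v i)).pow_const 2).aemeasurable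
    simp only [hf, ← Finset.prod_pow]
    rw [lintegral_prod_eq_prod_lintegral_of_indepFun Finset.univ _ hind
      (fun i => ((measurable_gaussianRatio (v i)).pow_const 2).comp (measurable_pi_apply i))]
    have : ∀ i, ∫⁻ x, gaussianRatio (v i) (x i) ^ 2 ∂μ
        = ENNReal.ofReal (√(v i * (2 - v i)))⁻¹ := fun i => by
      rw [← lintegral_gaussianRatio_sq (hpos i) (hlt i)]
      exact (measurePreserving_eval (fun _ : ι => gaussianReal 0 1) i).lintegral_comp
        ((measurable_gaussianRatio (v i)).pow_const 2)
    simp_rw [this]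
    rw [← ENNReal.ofReal_prod_of_nonneg fun _ _ => by positivity, Finset.prod_inv_distrib]
    have h2 : (2 : ℝ≥0∞) = ENNReal.ofReal 2 := by simp
    rw [h2]
    refine ENNReal.ofReal_le_ofReal ?_
    -- Since v(2 - v) = 1 - (v - 1)², the product of the second moments is at most (1 - 3/4)^{-1/2}
    -- = 2. This is where the constants 3/4 and 2 are linked.
    have h3 := one_sub_sum_le_prod_one_sub Finset.univ (fun i => ((v i : ℝ) - 1) ^ 2)
      (fun _ _ => sq_nonneg _) (fun i _ => (hi i).trans (by norm_num))
    have h4 : ∏ i, (1 - ((v i : ℝ) - 1) ^ 2) = ∏ i, ((v i : ℝ) * (2 - v i)) :=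
      Finset.prod_congr rfl fun i _ => by ring
    have h5 : (1 / 4 : ℝ) ≤ ∏ i, ((v i : ℝ) * (2 - v i)) := by rw [← h4]; linarith
    have h8 : ∀ i ∈ Finset.univ, 0 ≤ (v i : ℝ) * (2 - v i) := fun i _ =>
      mul_nonneg (v i).2 (sub_nonneg.2 (by exact_mod_cast (hlt i).le))
    rw [← Real.sqrt_prod _ h8]
    refine (inv_anti₀ (by positivity) (Real.sqrt_le_sqrt h5)).trans_eq ?_
    rw [show (1 / 4 : ℝ) = (1 / 2) ^ 2 by norm_num, Real.sqrt_sq (by norm_num)]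
    norm_num
  rw [hd, withDensity_apply _ hS, ← lintegral_indicator hS]
  have h6 : ∫⁻ x, S.indicator f x ∂μ = ∫⁻ x, f x * S.indicator (fun _ => 1) x ∂μ := by
    refine lintegral_congr fun x => ?_
    by_cases hx : x ∈ S <;> simp [hx]
  have h7 : ∫⁻ x, S.indicator (fun _ => (1 : ℝ≥0∞)) x ^ 2 ∂μ = μ S := by
    rw [← lintegral_indicator_one hS]
    refine lintegral_congr fun x => ?_
    by_cases hx : x ∈ S <;> simp [hx]
  rw [h6]
  refine (lintegral_mul_sq_le hfm.aemeasurable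
    ((measurable_const (a := (1 : ℝ≥0∞))).indicator hS).aemeasurable).trans ?_
  rw [h7]
  gcongr

end GaussianRatio

/-! ### Centered Gaussian vectors through their characteristic functions -/

section CharFun

open Matrix

variable {ι : Type*} [Fintype ι]

/-- The characteristic function of `μ` is that of the centered Gaussian law with covariance
matrix `A`. -/
def HasGaussianCharFun (μ : Measure (ι → ℝ)) (A : Matrix ι ι ℝ) : Prop :=
  ∀ a : ι → ℝ, ∫ y, Complex.exp (((a ⬝ᵥ y : ℝ) : ℂ) * Complex.I) ∂μ
    = Complex.exp (-((a ⬝ᵥ (A *ᵥ a) : ℝ) : ℂ) / 2)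

lemma measurable_mulVec (M : Matrix ι ι ℝ) : Measurable fun y : ι → ℝ => M *ᵥ y :=
  (LinearMap.continuous_of_finiteDimensional (Matrix.mulVecLin M)).measurable

lemma HasGaussianCharFun.map_mulVec {μ : Measure (ι → ℝ)} {A : Matrix ι ι ℝ}
    (h : HasGaussianCharFun μ A) (M : Matrix ι ι ℝ) :
    HasGaussianCharFun (μ.map fun y => M *ᵥ y) (M * A * Mᵀ) := by
  intro a
  have hm : Measurable fun y : ι → ℝ => Complex.exp (((a ⬝ᵥ y : ℝ) : ℂ) * Complex.I) := by
    unfold dotProduct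
    fun_prop
  rw [integral_map (measurable_mulVec M).aemeasurable hm.aestronglyMeasurable]
  have h1 : ∀ y, a ⬝ᵥ (M *ᵥ y) = (Mᵀ *ᵥ a) ⬝ᵥ y := fun y => by
    rw [dotProduct_mulVec, mulVec_transpose]
  simp_rw [h1]
  rw [h (Mᵀ *ᵥ a), ← h1, mulVec_mulVec, mulVec_mulVec, Matrix.mul_assoc]

lemma HasGaussianCharFun.ext [DecidableEq ι] {μ ν : Measure (ι → ℝ)} [IsFiniteMeasure μ]
    [IsFiniteMeasure ν] {A : Matrix ι ι ℝ} (hμ : HasGaussianCharFun μ A)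
    (hν : HasGaussianCharFun ν A) : μ = ν := by
  refine Measure.ext_of_charFunDual ?_
  ext L
  obtain ⟨a, hL⟩ : ∃ a : ι → ℝ, ∀ y, L y = a ⬝ᵥ y := by
    refine ⟨fun i => L (Pi.single i 1), fun y => ?_⟩
    conv_lhs => rw [pi_eq_sum_univ' y, map_sum]
    refine Finset.sum_congr rfl fun i _ => ?_
    rw [map_smul, smul_eq_mul, mul_comm]
  rw [charFunDual_apply, charFunDual_apply]
  simp_rw [hL]
  rw [hμ a, hν a]

lemma hasGaussianCharFun_pi [DecidableEq ι] (v : ι → ℝ≥0) :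
    HasGaussianCharFun (Measure.pi fun i => gaussianReal 0 (v i))
      (Matrix.diagonal fun i => (v i : ℝ)) := by
  intro a
  have h1 : ∀ y : ι → ℝ, Complex.exp (((a ⬝ᵥ y : ℝ) : ℂ) * Complex.I)
      = ∏ i, Complex.exp ((a i : ℂ) * (y i : ℂ) * Complex.I) := fun y => by
    rw [← Complex.exp_sum, dotProduct]
    push_cast
    rw [Finset.sum_mul]
  simp_rw [h1]
  rw [integral_fintype_prod_eq_prod
    (f := fun i (x : ℝ) => Complex.exp ((a i : ℂ) * (x : ℂ) * Complex.I))]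
  have h2 : ∀ i, ∫ x : ℝ, Complex.exp ((a i : ℂ) * (x : ℂ) * Complex.I) ∂(gaussianReal 0 (v i))
      = Complex.exp (-(v i * a i ^ 2 / 2)) := fun i => by
    rw [← charFun_apply_real, charFun_gaussianReal]
    congr 1
    push_cast
    ring
  simp_rw [h2]
  rw [← Complex.exp_sum]
  congr 1
  simp only [dotProduct, mulVec_diagonal]
  push_cast
  rw [Finset.sum_neg_distrib, neg_div, Finset.sum_div]
  congr 1
  exact Finset.sum_congr rfl fun i _ => by ring

end CharFun

/-! ### Simultaneous diagonalization and the chi-square bound for general covariances -/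

section Diagonalization

open Matrix

variable {ι : Type*} [Fintype ι] [DecidableEq ι]

lemma exists_orthogonal_diagonal {A : Matrix ι ι ℝ} (hA : A.IsHermitian) :
    ∃ O : Matrix ι ι ℝ, O * Oᵀ = 1 ∧ O * A * Oᵀ = diagonal hA.eigenvalues := by
  refine ⟨star (hA.eigenvectorUnitary : Matrix ι ι ℝ), ?_, ?_⟩
  · have := Unitary.coe_star_mul_self hA.eigenvectorUnitary
    simpa [star_eq_conjTranspose, conjTranspose_eq_transpose_of_trivial] using this
  · have := hA.conjStarAlgAut_star_eigenvectorUnitary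
    rw [Unitary.conjStarAlgAut_star_apply] at this
    simpa [star_eq_conjTranspose, conjTranspose_eq_transpose_of_trivial] using this

/-- Simultaneous diagonalization of a positive definite and a symmetric matrix. -/
lemma exists_simultaneous_diagonal {A B : Matrix ι ι ℝ} (hA : A.PosDef) (hB : B.IsHermitian) :
    ∃ (M : Matrix ι ι ℝ) (d : ι → ℝ), M * A * Mᵀ = 1 ∧ M * B * Mᵀ = diagonal d := by
  obtain ⟨O, hO, hOA⟩ := exists_orthogonal_diagonal hA.isHermitian
  set s : ι → ℝ := fun i => (√(hA.isHermitian.eigenvalues i))⁻¹ with hs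
  set C := diagonal s * O with hC
  have hCA : C * A * Cᵀ = 1 := by
    have : C * A * Cᵀ = diagonal s * (O * A * Oᵀ) * diagonal s := by
      rw [hC, transpose_mul, diagonal_transpose]; simp only [Matrix.mul_assoc]
    rw [this, hOA, diagonal_mul_diagonal, diagonal_mul_diagonal, ← diagonal_one]
    congr 1
    ext i
    have hp := hA.eigenvalues_pos i
    have h2 := Real.mul_self_sqrt hp.le
    have h3 := Real.sqrt_pos.2 hp
    simp only [hs]
    field_simp
    rw [sq, h2]
  clear_value C
  have hCB : (C * B * Cᵀ).IsHermitian := by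
    have hB' : Bᵀ = B := hB
    change (C * B * Cᵀ)ᵀ = _
    rw [transpose_mul, transpose_mul, transpose_transpose, hB', Matrix.mul_assoc]
  obtain ⟨R, hR, hRB⟩ := exists_orthogonal_diagonal hCB
  refine ⟨R * C, hCB.eigenvalues, ?_, ?_⟩
  rotate_left
  · rw [← hRB, transpose_mul]; simp only [Matrix.mul_assoc]
  · have : R * C * A * (R * C)ᵀ = R * (C * A * Cᵀ) * Rᵀ := by
      rw [transpose_mul]; simp only [Matrix.mul_assoc]
    rw [this, hCA, Matrix.mul_one, hR]

/-- Centered Gaussian laws with close covariance matrices: a bound coming from the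
chi-square distance. -/
lemma HasGaussianCharFun.sq_le {μ₀ μ₁ : Measure (ι → ℝ)} [IsFiniteMeasure μ₀] [IsFiniteMeasure μ₁]
    {A B : Matrix ι ι ℝ} (hA : A.PosDef) (hB : B.IsHermitian) (h₀ : HasGaussianCharFun μ₀ A)
    (h₁ : HasGaussianCharFun μ₁ (A + B)) (hAB : (A⁻¹ * B * (A⁻¹ * B)).trace ≤ 3 / 4)
    {S : Set (ι → ℝ)} (hS : MeasurableSet S) : μ₁ S ^ 2 ≤ 2 * μ₀ S := by
  obtain ⟨M, d, hMA, hMB⟩ := exists_simultaneous_diagonal hA hB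
  have hM : M * (A * Mᵀ) = 1 := by rw [← Matrix.mul_assoc, hMA]
  have hM' : A * Mᵀ * M = 1 := mul_eq_one_comm.1 hM
  -- With A⁻¹ = MᵀM, cyclicity of the trace turns tr((A⁻¹B)²) into the sum of the d i ^ 2. The map M
  -- sends the two laws to product measures with variances 1 and 1 + d i, and A Mᵀ is its inverse,
  -- which transports the event S.
  have hinv : A⁻¹ = Mᵀ * M := inv_eq_right_inv (by rw [← Matrix.mul_assoc, hM'])
  have hsum : ∑ i, d i ^ 2 ≤ 3 / 4 := by
    refine le_trans (le_of_eq ?_) hAB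
    have : (diagonal d * diagonal d).trace = ∑ i, d i ^ 2 := by
      rw [diagonal_mul_diagonal, trace_diagonal]
      exact Finset.sum_congr rfl fun i _ => by ring
    rw [← this, ← hMB, hinv]
    have e2 : Mᵀ * M * B * (Mᵀ * M * B) = Mᵀ * (M * B * Mᵀ * M * B) := by
      simp only [Matrix.mul_assoc]
    rw [e2, trace_mul_comm Mᵀ]
    simp only [Matrix.mul_assoc]
  have hd : ∀ i, 0 ≤ 1 + d i := fun i => by
    have := (Finset.single_le_sum (f := fun i => d i ^ 2) (fun _ _ => sq_nonneg _)
      (Finset.mem_univ i)).trans hsum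
    nlinarith
  set v : ι → ℝ≥0 := fun i => ⟨1 + d i, hd i⟩
  have hv : ∀ i, (v i : ℝ) = 1 + d i := fun _ => rfl
  have l₀ : μ₀.map (fun y => M *ᵥ y) = Measure.pi fun _ => gaussianReal 0 1 := by
    have h := h₀.map_mulVec M
    rw [hMA] at h
    exact h.ext (by simpa using hasGaussianCharFun_pi fun _ : ι => 1)
  have l₁ : μ₁.map (fun y => M *ᵥ y) = Measure.pi fun i => gaussianReal 0 (v i) := by
    have h := h₁.map_mulVec M
    rw [Matrix.mul_add, Matrix.add_mul, hMA, hMB, ← diagonal_one, diagonal_add] at h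
    exact h.ext (hasGaussianCharFun_pi v)
  have hT : MeasurableSet ((fun z => (A * Mᵀ) *ᵥ z) ⁻¹' S) := measurable_mulVec _ hS
  have hpre : (fun y => M *ᵥ y) ⁻¹' ((fun z => (A * Mᵀ) *ᵥ z) ⁻¹' S) = S := by
    ext y
    simp [mulVec_mulVec, hM']
  have key := pi_gaussianReal_sq_le v (by
    refine le_trans (le_of_eq (Finset.sum_congr rfl fun i _ => ?_)) hsum
    rw [hv, add_sub_cancel_left]) hT
  rwa [← l₀, ← l₁, Measure.map_apply (measurable_mulVec _) hT,
    Measure.map_apply (measurable_mulVec _) hT, hpre] at key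

end Diagonalization

/-! ### Partial sums, a discrete Agmon inequality and bounds for the sandwiched inverse -/

section MatrixBound

open Matrix

variable {n : ℕ}

/-- The lower triangular matrix that forms partial sums. -/
def partialSumMatrix (n : ℕ) : Matrix (Fin n) (Fin n) ℝ :=
  Matrix.of fun i j => if j ≤ i then 1 else 0

lemma partialSumMatrix_transpose_mulVec (z : Fin n → ℝ) (k : Fin n) :
    ((partialSumMatrix n)ᵀ *ᵥ z) k = ∑ i : Fin n, if (k : ℕ) ≤ i then z i else 0 := by
  rw [mulVec, dotProduct]
  refine Finset.sum_congr rfl fun i _ => ?_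
  simp only [transpose_apply, partialSumMatrix, of_apply, Fin.le_def, ite_mul, one_mul, zero_mul]

lemma sum_tail_succ (f : Fin n → ℝ) {k : ℕ} (hk : k < n) :
    (∑ i : Fin n, if k ≤ (i : ℕ) then f i else 0)
      = f ⟨k, hk⟩ + ∑ i : Fin n, if k + 1 ≤ (i : ℕ) then f i else 0 := by
  have : ∀ i : Fin n, (if k ≤ (i : ℕ) then f i else 0)
      = (if i = ⟨k, hk⟩ then f i else 0) + if k + 1 ≤ (i : ℕ) then f i else 0 := by
    intro i
    have h : i = ⟨k, hk⟩ ↔ (i : ℕ) = k := Fin.ext_iff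
    simp only [h]
    split_ifs <;> first | omega | simp
  rw [Finset.sum_congr rfl fun i _ => this i, Finset.sum_add_distrib, Finset.sum_ite_eq']
  simp

/-- A discrete Agmon inequality. -/
lemma agmon_partialSum (a b : ℝ) (z : Fin n → ℝ) (k : Fin n) :
    a * b * (((partialSumMatrix n)ᵀ *ᵥ z) k) ^ 2
      ≤ a ^ 2 * ∑ i, (((partialSumMatrix n)ᵀ *ᵥ z) i) ^ 2 + b ^ 2 * ∑ i, z i ^ 2 := by
  set x : Fin n → ℝ := (partialSumMatrix n)ᵀ *ᵥ z with hx
  set X : ℕ → ℝ := fun k => ∑ i : Fin n, if k ≤ (i : ℕ) then z i else 0 with hX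
  have hxX : ∀ i : Fin n, x i = X i := fun i => partialSumMatrix_transpose_mulVec z i
  set f : Fin n → ℝ := fun i => a ^ 2 * x i ^ 2 + b ^ 2 * z i ^ 2 with hf
  have hf0 : ∀ i, 0 ≤ f i := fun i => by simp only [hf]; positivity
  -- Downward induction from X n = 0, where X k is the tail sum of z. The extra a²/2 makes the step
  -- close: the gap between the two sides is exactly half the sum of the two squares given to
  -- `nlinarith`. No sign of a or b is needed.
  have main : ∀ k ≤ n, a * b * X k ^ 2 + a ^ 2 / 2 * X k ^ 2
      ≤ ∑ i : Fin n, if k ≤ (i : ℕ) then f i else 0 := by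
    intro k hk
    induction hk using Nat.decreasingInduction with
    | self =>
      have : X n = 0 := Finset.sum_eq_zero fun i _ => if_neg (by omega)
      rw [this]
      simp only [ne_eq, OfNat.ofNat_ne_zero, not_false_eq_true, zero_pow, mul_zero, add_zero]
      exact Finset.sum_nonneg fun i _ => by split_ifs; exacts [hf0 i, le_rfl]
    | of_succ k hk ih =>
      have h1 : X k = z ⟨k, hk⟩ + X (k + 1) := sum_tail_succ z hk
      rw [sum_tail_succ f hk]
      have h2 : f ⟨k, hk⟩ = a ^ 2 * X k ^ 2 + b ^ 2 * z ⟨k, hk⟩ ^ 2 := by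
        simp only [hf]; rw [hxX]
      rw [h2]
      have h3 : z ⟨k, hk⟩ = X k - X (k + 1) := by rw [h1]; ring
      rw [h3] at *
      nlinarith [sq_nonneg (a * X k - b * (X k - X (k + 1))),
        sq_nonneg (a * X (k + 1) - b * (X k - X (k + 1)))]
  have h1 := main k k.2.le
  rw [← hxX] at h1
  have h2 : (∑ i : Fin n, if (k : ℕ) ≤ (i : ℕ) then f i else 0) ≤ ∑ i, f i :=
    Finset.sum_le_sum fun i _ => by split_ifs; exacts [le_rfl, hf0 i]
  have h3 : ∑ i, f i = a ^ 2 * ∑ i, x i ^ 2 + b ^ 2 * ∑ i, z i ^ 2 := by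
    rw [Finset.mul_sum, Finset.mul_sum, ← Finset.sum_add_distrib]
  have h4 : 0 ≤ a ^ 2 / 2 * x k ^ 2 := by positivity
  linarith

/-- The covariance matrix of the observations, where `d` are the variances of the increments of
the integrated signal, `D` is a multiplier and `t` the noise level. -/
noncomputable def covMatrix (D d : Fin n → ℝ) (t : ℝ) : Matrix (Fin n) (Fin n) ℝ :=
  diagonal D * partialSumMatrix n * diagonal d * (diagonal D * partialSumMatrix n)ᵀ + t ^ 2 • 1

lemma covMatrix_posDef {D d : Fin n → ℝ} {t : ℝ} (hd : ∀ i, 0 ≤ d i) (ht : 0 < t) :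
    (covMatrix D d t).PosDef := by
  refine Matrix.PosDef.posSemidef_add ?_ (Matrix.PosDef.one.smul (by positivity))
  have := (PosSemidef.diagonal (d := d) hd).mul_mul_conjTranspose_same
    (diagonal D * partialSumMatrix n)
  simpa [conjTranspose_eq_transpose_of_trivial] using this

/-- Pair the entries M i j and M j i by the inequality of arithmetic and geometric means. Symmetry
is not available in the application, where M is a product of G with a perturbation. -/
lemma trace_mul_self_le (M : Matrix (Fin n) (Fin n) ℝ) :
    (M * M).trace ≤ ∑ j, ∑ i, M i j ^ 2 := by
  have h1 : (M * M).trace = ∑ j, ∑ i, M i j * M j i := by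
    rw [trace_mul_comm]
    simp only [trace, diag, mul_apply]
    exact Finset.sum_congr rfl fun _ _ => Finset.sum_congr rfl fun _ _ => mul_comm _ _
  have h2 : ∑ j, ∑ i, M j i ^ 2 = ∑ j, ∑ i, M i j ^ 2 := Finset.sum_comm
  have h3 : ∑ j, ∑ i, M i j * M j i ≤ ∑ j, ∑ i, (M i j ^ 2 + M j i ^ 2) / 2 :=
    Finset.sum_le_sum fun j _ => Finset.sum_le_sum fun i _ => by
      nlinarith [sq_nonneg (M i j - M j i)]
  have h4 : ∑ j, ∑ i, (M i j ^ 2 + M j i ^ 2) / 2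
      = (∑ j, ∑ i, M i j ^ 2 + ∑ j, ∑ i, M j i ^ 2) / 2 := by
    simp only [← Finset.sum_div, Finset.sum_add_distrib]
  rw [h1]
  linarith

section Resolvent

variable (D d : Fin n → ℝ) (t : ℝ)

/-- The sandwiched inverse `Uᵀ A⁻¹ U` of the covariance matrix `A = U diag(d) Uᵀ + t²`. -/
noncomputable def sandwich : Matrix (Fin n) (Fin n) ℝ :=
  (diagonal D * partialSumMatrix n)ᵀ * (covMatrix D d t)⁻¹ * (diagonal D * partialSumMatrix n)

variable {D d t} {a b : ℝ}

/-- With v = A⁻¹Uy and x = Uᵀv = Gy, the equation Av = Uy gives the energy identity y·x = ∑ d x² +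
t² ∑ v². Its first term controls x in ℓ². As x is the tail sum of D v, whose ℓ² norm is controlled
by the second term, the Agmon inequality bounds x pointwise. -/
lemma sandwich_quadratic (ht : 0 < t) (hd : ∀ i, a ^ 2 ≤ d i)
    (hD : ∀ i, b ^ 2 * D i ^ 2 ≤ t ^ 2) (y : Fin n → ℝ) :
    a ^ 2 * ∑ i, ((sandwich D d t *ᵥ y) i) ^ 2 ≤ y ⬝ᵥ (sandwich D d t *ᵥ y) ∧
    ∀ k, a * b * ((sandwich D d t *ᵥ y) k) ^ 2 ≤ y ⬝ᵥ (sandwich D d t *ᵥ y) := by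
  have hA := covMatrix_posDef (D := D) (fun i => (sq_nonneg a).trans (hd i)) ht
  set A := covMatrix D d t with hAdef
  set U := diagonal D * partialSumMatrix n with hU
  set v := A⁻¹ *ᵥ (U *ᵥ y) with hv
  have hAv : A *ᵥ v = U *ᵥ y := by
    rw [hv, mulVec_mulVec, mul_nonsing_inv _ ((isUnit_iff_isUnit_det _).1 hA.isUnit), one_mulVec]
  set x := sandwich D d t *ᵥ y with hx
  have hxv : x = Uᵀ *ᵥ v := by
    rw [hx, hv, sandwich, mulVec_mulVec, mulVec_mulVec, ← hU, ← hAdef, Matrix.mul_assoc]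
  have hxz : x = (partialSumMatrix n)ᵀ *ᵥ (fun i => D i * v i) := by
    rw [hxv, hU, transpose_mul, diagonal_transpose, ← mulVec_mulVec]
    congr 1
    ext i
    rw [mulVec_diagonal]
  have hq : y ⬝ᵥ x = ∑ i, d i * x i ^ 2 + t ^ 2 * ∑ i, v i ^ 2 := by
    have h1 : y ⬝ᵥ x = (U *ᵥ y) ⬝ᵥ v := by
      rw [hxv, dotProduct_mulVec, vecMul_transpose]
    rw [h1, ← hAv, hAdef, covMatrix, ← hU, add_mulVec, add_dotProduct]
    congr 1
    · rw [← mulVec_mulVec, ← hxv, ← mulVec_mulVec, dotProduct_comm, dotProduct_mulVec,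
        ← mulVec_transpose, ← hxv]
      simp only [dotProduct, mulVec_diagonal]
      exact Finset.sum_congr rfl fun i _ => by ring
    · rw [smul_mulVec, one_mulVec, smul_dotProduct, smul_eq_mul]
      simp only [dotProduct, sq]
  have h1 : a ^ 2 * ∑ i, x i ^ 2 ≤ ∑ i, d i * x i ^ 2 := by
    rw [Finset.mul_sum]
    exact Finset.sum_le_sum fun i _ => mul_le_mul_of_nonneg_right (hd i) (sq_nonneg _)
  have h2 : b ^ 2 * ∑ i, (D i * v i) ^ 2 ≤ t ^ 2 * ∑ i, v i ^ 2 := by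
    rw [Finset.mul_sum, Finset.mul_sum]
    refine Finset.sum_le_sum fun i _ => ?_
    rw [mul_pow, ← mul_assoc]
    exact mul_le_mul_of_nonneg_right (hD i) (sq_nonneg _)
  have h3 : 0 ≤ t ^ 2 * ∑ i, v i ^ 2 := by positivity
  refine ⟨by linarith, fun k => ?_⟩
  have h4 := agmon_partialSum a b (fun i => D i * v i) k
  rw [← hxz] at h4
  linarith

/-- The coercivity a²‖x‖² ≤ y·x for x = Gy and Young's inequality yield the operator norm bound ‖G‖
≤ a⁻². -/
lemma sandwich_mulVec_sq_le (ha : 0 < a) (ht : 0 < t) (hd : ∀ i, a ^ 2 ≤ d i)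
    (hD : ∀ i, b ^ 2 * D i ^ 2 ≤ t ^ 2) (y : Fin n → ℝ) :
    ∑ i, ((sandwich D d t *ᵥ y) i) ^ 2 ≤ (a ^ 4)⁻¹ * ∑ i, y i ^ 2 := by
  have h := (sandwich_quadratic ht hd hD y).1
  set x := sandwich D d t *ᵥ y
  have h1 : y ⬝ᵥ x ≤ a ^ 2 / 2 * ∑ i, x i ^ 2 + (a ^ 2)⁻¹ / 2 * ∑ i, y i ^ 2 := by
    rw [Finset.mul_sum, Finset.mul_sum, ← Finset.sum_add_distrib, dotProduct]
    refine Finset.sum_le_sum fun i _ => ?_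
    have : a ^ 2 / 2 * x i ^ 2 + (a ^ 2)⁻¹ / 2 * y i ^ 2 - y i * x i
        = (a * x i - a⁻¹ * y i) ^ 2 / 2 := by
      field_simp
      ring
    nlinarith [sq_nonneg (a * x i - a⁻¹ * y i)]
  have h2 : a ^ 2 * ∑ i, x i ^ 2 ≤ (a ^ 2)⁻¹ * ∑ i, y i ^ 2 := by linarith
  have h3 : (a ^ 4)⁻¹ = (a ^ 2)⁻¹ * (a ^ 2)⁻¹ := by rw [← mul_inv, ← pow_add]
  rw [h3, mul_assoc, ← div_eq_inv_mul, le_div_iff₀ (by positivity)]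
  linarith

/-- Test the quadratic form with a unit vector and put g = G j j. The pointwise bound reads a b g² ≤
g, so g ≤ 1/(ab), and the ℓ² bound says that column j has squared norm at most g/a². With a of order
n^{-1/2} and b of order 1 the total is of order n^{5/2}. -/
lemma sum_sandwich_sq_le (ha : 0 < a) (hb : 0 < b) (ht : 0 < t) (hd : ∀ i, a ^ 2 ≤ d i)
    (hD : ∀ i, b ^ 2 * D i ^ 2 ≤ t ^ 2) :
    ∑ j, ∑ i, (sandwich D d t i j) ^ 2 ≤ n / (a ^ 3 * b) := by
  have : ∀ j, ∑ i, (sandwich D d t i j) ^ 2 ≤ 1 / (a ^ 3 * b) := by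
    intro j
    have h := sandwich_quadratic ht hd hD (Pi.single j 1)
    simp only [mulVec_single_one, single_one_dotProduct, col_apply] at h
    have h1 := h.2 j
    set g := sandwich D d t j j
    have hab : 0 < a * b := mul_pos ha hb
    have h2 : g ≤ 1 / (a * b) := by
      rw [le_div_iff₀ hab]
      by_contra hcon
      push Not at hcon
      have hg : 0 < g := by
        by_contra hg
        nlinarith
      nlinarith
    have h3 : (1 : ℝ) / (a ^ 3 * b) = 1 / (a * b) / a ^ 2 := by
      field_simp
    rw [h3, le_div_iff₀ (by positivity)]
    linarith [h.1]
  refine (Finset.sum_le_sum fun j _ => this j).trans (le_of_eq ?_)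
  simp [div_eq_mul_inv]

/-- The size of a perturbation `U (diag β + E) Uᵀ` relative to the covariance matrix. -/
lemma trace_perturbation_le (ha : 0 < a) (hb : 0 < b) (ht : 0 < t) (hd : ∀ i, a ^ 2 ≤ d i)
    (hD : ∀ i, b ^ 2 * D i ^ 2 ≤ t ^ 2) (β : Fin n → ℝ) (E : Matrix (Fin n) (Fin n) ℝ) {η e : ℝ}
    (hη : 0 ≤ η) (hβ : ∀ i, β i ^ 2 ≤ η) (hE : ∑ j, ∑ i, E i j ^ 2 ≤ e) {B : Matrix (Fin n) (Fin n) ℝ}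
    (hB : B = diagonal D * partialSumMatrix n * (diagonal β + E)
      * (diagonal D * partialSumMatrix n)ᵀ) :
    ((covMatrix D d t)⁻¹ * B * ((covMatrix D d t)⁻¹ * B)).trace
      ≤ 2 * η * (n / (a ^ 3 * b)) + 2 * e / a ^ 4 := by
  set U := diagonal D * partialSumMatrix n with hU
  set A := covMatrix D d t with hA
  set G := sandwich D d t with hG
  -- Cyclicity moves the last Uᵀ to the front, so that only G = UᵀA⁻¹U and the inner perturbation
  -- remain. Below, the diagonal part is paired with the Hilbert-Schmidt norm of G, and E, column by
  -- column, with its operator norm.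
  have h1 : (A⁻¹ * B * (A⁻¹ * B)).trace
      = (G * (diagonal β + E) * (G * (diagonal β + E))).trace := by
    have e1 : A⁻¹ * B * (A⁻¹ * B)
        = (A⁻¹ * U * (diagonal β + E) * Uᵀ * A⁻¹ * U * (diagonal β + E)) * Uᵀ := by
      rw [hB]; simp only [Matrix.mul_assoc]
    rw [e1, trace_mul_comm, hG, sandwich, ← hU, ← hA]
    simp only [Matrix.mul_assoc]
  rw [h1]
  refine (trace_mul_self_le _).trans ?_
  have h2 : ∀ i j, (G * (diagonal β + E)) i j ^ 2
      ≤ 2 * η * G i j ^ 2 + 2 * (G *ᵥ (fun k => E k j)) i ^ 2 := by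
    intro i j
    have : (G * (diagonal β + E)) i j = G i j * β j + (G *ᵥ (fun k => E k j)) i := by
      rw [Matrix.mul_add, Matrix.add_apply, mul_diagonal]
      rfl
    rw [this]
    nlinarith [sq_nonneg (G i j * β j - (G *ᵥ (fun k => E k j)) i),
      mul_le_mul_of_nonneg_left (hβ j) (sq_nonneg (G i j))]
  have h3 := sum_sandwich_sq_le ha hb ht hd hD
  calc ∑ j, ∑ i, (G * (diagonal β + E)) i j ^ 2
      ≤ ∑ j, ∑ i, (2 * η * G i j ^ 2 + 2 * (G *ᵥ (fun k => E k j)) i ^ 2) :=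
        Finset.sum_le_sum fun j _ => Finset.sum_le_sum fun i _ => h2 i j
    _ = 2 * η * ∑ j, ∑ i, G i j ^ 2 + 2 * ∑ j, ∑ i, (G *ᵥ (fun k => E k j)) i ^ 2 := by
        simp only [Finset.sum_add_distrib, Finset.mul_sum]
    _ ≤ 2 * η * (n / (a ^ 3 * b)) + 2 * ∑ j, (a ^ 4)⁻¹ * ∑ i, E i j ^ 2 := by
        refine add_le_add ?_ (mul_le_mul_of_nonneg_left
          (Finset.sum_le_sum fun j _ => sandwich_mulVec_sq_le ha ht hd hD _) (by norm_num))
        exact mul_le_mul_of_nonneg_left h3 (by positivity)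
    _ ≤ 2 * η * (n / (a ^ 3 * b)) + 2 * e / a ^ 4 := by
        rw [← Finset.mul_sum, mul_div_assoc 2 e, div_eq_inv_mul e]
        gcongr

end Resolvent

end MatrixBound

/-! ### Joint Gaussianity of Wiener integrals -/

section WienerLaw

variable {Ω : Type*} [MeasurableSpace Ω] {W : ℝ≥0 → Ω → ℝ} {P : Measure Ω}

lemma hasGaussianLaw_stepIntLp (hW : IsPreBrownianReal W P) (s : ℝ≥0 →₀ ℝ) :
    HasGaussianLaw (stepIntLp hW s) P := by
  have h1 := (hW.isGaussianProcess.smul (fun b => s b)).hasGaussianLaw_fun_sum (I := s.support)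
  refine h1.congr ?_
  filter_upwards [stepIntLp_coe hW s, hW.eval_zero_ae_eq_zero] with ω h2 h3
  rw [h2, stepIntegral, Finsupp.sum, h3]
  simp

lemma integral_stepIntLp (hW : IsPreBrownianReal W P) (s : ℝ≥0 →₀ ℝ) :
    ∫ ω, stepIntLp hW s ω ∂P = 0 := by
  rw [integral_congr_ae (stepIntLp_coe hW s)]
  simp only [stepIntegral, Finsupp.sum]
  have hint : ∀ b ∈ s.support, Integrable (fun ω => s b * (W b ω - W 0 ω)) P := fun b _ =>
    ((hW.integrable_eval b).sub (hW.integrable_eval 0)).const_mul (s b)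
  rw [integral_finsetSum _ hint]
  refine Finset.sum_eq_zero fun b _ => ?_
  rw [integral_const_mul, integral_sub (hW.integrable_eval b) (hW.integrable_eval 0),
    hW.integral_eval, hW.integral_eval, sub_self, mul_zero]

lemma integral_exp_stepIntLp (hW : IsPreBrownianReal W P) (s : ℝ≥0 →₀ ℝ) :
    ∫ ω, Complex.exp (((stepIntLp hW s ω : ℝ) : ℂ) * Complex.I) ∂P
      = Complex.exp (-((‖stepLp s‖ ^ 2 : ℝ) : ℂ) / 2) := by
  have := hW.isGaussianProcess.isProbabilityMeasure
  have hG := hasGaussianLaw_stepIntLp hW s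
  have h1 := hG.map_eq_gaussianReal
  have hv : Var[stepIntLp hW s; P] = ‖stepLp s‖ ^ 2 := by
    rw [variance_of_integral_eq_zero hG.aemeasurable (integral_stepIntLp hW s),
      ← isometry_step hW, ← real_inner_self_eq_norm_sq, L2.inner_def]
    simp [sq]
  rw [integral_stepIntLp, hv] at h1
  have h2 := charFun_gaussianReal (μ := 0) (v := (‖stepLp s‖ ^ 2).toNNReal) 1
  rw [← h1, charFun_apply_real, integral_map hG.aemeasurable
    (Measurable.aestronglyMeasurable (by fun_prop))] at h2
  simp only [Complex.ofReal_one, one_mul] at h2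
  rw [h2, Real.coe_toNNReal _ (by positivity)]
  congr 1
  push_cast
  ring

/-- The closure of the graph of the Wiener integral on step functions. -/
noncomputable def wienerGraph (hW : IsPreBrownianReal W P) :
    Submodule ℝ (Lp ℝ 2 (volume.restrict (Ioi (0 : ℝ))) × Lp ℝ 2 P) :=
  (LinearMap.range (stepLp.prod (stepIntLp hW))).topologicalClosure

/-- The identity for step functions survives L² limits. Since the closed graph is a linear subspace,
it then applies to every linear combination of Wiener integrals, which gives their joint law with no
separate limit argument and for any choice of version. -/
lemma integral_exp_of_mem_wienerGraph (hW : IsPreBrownianReal W P)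
    {q : Lp ℝ 2 (volume.restrict (Ioi (0 : ℝ))) × Lp ℝ 2 P} (hq : q ∈ wienerGraph hW) :
    ∫ ω, Complex.exp (((q.2 ω : ℝ) : ℂ) * Complex.I) ∂P
      = Complex.exp (-((‖q.1‖ ^ 2 : ℝ) : ℂ) / 2) := by
  have := hW.isGaussianProcess.isProbabilityMeasure
  obtain ⟨y, hy, hlim⟩ := mem_closure_iff_seq_limit.1 hq
  choose s hs using hy
  have h1 : Tendsto (fun k => stepLp (s k)) atTop (𝓝 q.1) := by
    have := (continuous_fst.tendsto q).comp hlim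
    refine this.congr fun k => ?_
    simp [← hs k]
  have h2 : Tendsto (fun k => stepIntLp hW (s k)) atTop (𝓝 q.2) := by
    have := (continuous_snd.tendsto q).comp hlim
    refine this.congr fun k => ?_
    simp [← hs k]
  -- Pass to an almost surely convergent subsequence; the exponentials have modulus 1, so dominated
  -- convergence applies.
  obtain ⟨φ, hφ, hae⟩ := (tendstoInMeasure_of_tendsto_Lp h2).exists_seq_tendsto_ae
  have h3 : Tendsto (fun k => ∫ ω, Complex.exp (((stepIntLp hW (s (φ k)) ω : ℝ) : ℂ) * Complex.I) ∂P)
      atTop (𝓝 (∫ ω, Complex.exp (((q.2 ω : ℝ) : ℂ) * Complex.I) ∂P)) := by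
    refine tendsto_integral_of_dominated_convergence (fun _ => 1) (fun k => ?_)
      (integrable_const _) (fun k => ?_) ?_
    · exact (by fun_prop : Continuous fun x : ℝ =>
        Complex.exp ((x : ℂ) * Complex.I)).comp_aestronglyMeasurable (Lp.aestronglyMeasurable _)
    · exact Eventually.of_forall fun ω => by rw [Complex.norm_exp_ofReal_mul_I]
    · filter_upwards [hae] with ω hω
      exact ((by fun_prop : Continuous fun x : ℝ =>
        Complex.exp ((x : ℂ) * Complex.I)).tendsto _).comp hω
  simp only [integral_exp_stepIntLp] at h3
  refine tendsto_nhds_unique h3 ?_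
  exact ((by fun_prop : Continuous fun f : Lp ℝ 2 (volume.restrict (Ioi (0 : ℝ))) =>
    Complex.exp (-((‖f‖ ^ 2 : ℝ) : ℂ) / 2)).tendsto _).comp (h1.comp hφ.tendsto_atTop)

lemma IsWienerIntegral.mem_wienerGraph (hW : IsPreBrownianReal W P) {h : ℝ → ℝ} {I : Ω → ℝ}
    (hh : MemLp h 2 (volume.restrict (Ioi (0 : ℝ)))) (hI : IsWienerIntegral W P h I) :
    (hh.toLp h, hI.1.toLp I) ∈ wienerGraph hW := by
  obtain ⟨hI1, s, h1, h2⟩ := hI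
  refine mem_closure_iff_seq_limit.2 ⟨fun k => (stepLp (s k), stepIntLp hW (s k)),
    fun k => ⟨s k, rfl⟩, ?_⟩
  refine Tendsto.prodMk_nhds ?_ ?_
  · rw [Lp.tendsto_Lp_iff_tendsto_eLpNorm]
    refine h1.congr fun k => eLpNorm_congr_ae ?_
    filter_upwards [stepLp_coe (s k)] with x hx
    simp [hx]
  · rw [Lp.tendsto_Lp_iff_tendsto_eLpNorm]
    refine h2.congr fun k => eLpNorm_congr_ae ?_
    filter_upwards [stepIntLp_coe hW (s k)] with x hx
    simp [hx]

/-- Wiener integrals are jointly centered Gaussian, with covariances `∫ hᵢ hⱼ`. -/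
lemma IsWienerIntegral.integral_exp_sum (hW : IsPreBrownianReal W P) {ι : Type*} [Fintype ι]
    {h : ι → ℝ → ℝ} {X : ι → Ω → ℝ} (hh : ∀ i, MemLp (h i) 2 (volume.restrict (Ioi (0 : ℝ))))
    (hX : ∀ i, IsWienerIntegral W P (h i) (X i)) (a : ι → ℝ) :
    ∫ ω, Complex.exp (((∑ i, a i * X i ω : ℝ) : ℂ) * Complex.I) ∂P
      = Complex.exp (-((∑ i, ∑ j, a i * a j * ∫ x in Ioi (0 : ℝ), h i x * h j x : ℝ) : ℂ) / 2) := by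
  have hmem : ∑ i, a i • ((hh i).toLp (h i), (hX i).1.toLp (X i)) ∈ wienerGraph hW :=
    Submodule.sum_mem _ fun i _ => Submodule.smul_mem _ _ ((hX i).mem_wienerGraph hW (hh i))
  have key := integral_exp_of_mem_wienerGraph hW hmem
  rw [Prod.fst_sum, Prod.snd_sum] at key
  simp only [Prod.smul_fst, Prod.smul_snd] at key
  have h1 : ((∑ i, a i • (hX i).1.toLp (X i) : Lp ℝ 2 P) : Ω → ℝ)
      =ᵐ[P] fun ω => ∑ i, a i * X i ω := by
    have e1 : ∀ᵐ ω ∂P, ∀ i, (a i • (hX i).1.toLp (X i) : Lp ℝ 2 P) ω = a i * X i ω := by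
      refine ae_all_iff.2 fun i => ?_
      filter_upwards [Lp.coeFn_smul (a i) ((hX i).1.toLp (X i)), (hX i).1.coeFn_toLp]
        with ω h1 h2
      rw [h1, Pi.smul_apply, h2, smul_eq_mul]
    filter_upwards [Lp.coeFn_finsetSum Finset.univ fun i => a i • (hX i).1.toLp (X i), e1]
      with ω h1 h2
    rw [h1, Finset.sum_apply]
    exact Finset.sum_congr rfl fun i _ => h2 i
  have h2 : ‖∑ i, a i • (hh i).toLp (h i)‖ ^ 2
      = ∑ i, ∑ j, a i * a j * ∫ x in Ioi (0 : ℝ), h i x * h j x := by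
    rw [← real_inner_self_eq_norm_sq, sum_inner]
    refine Finset.sum_congr rfl fun i _ => ?_
    rw [inner_sum]
    refine Finset.sum_congr rfl fun j _ => ?_
    rw [real_inner_smul_left, real_inner_smul_right, ← mul_assoc, L2.inner_def]
    congr 1
    refine integral_congr_ae ?_
    filter_upwards [(hh i).coeFn_toLp, (hh j).coeFn_toLp] with x h3 h4
    rw [h3, h4]
    simp [mul_comm]
  rw [h2] at key
  rw [← key]
  refine integral_congr_ae ?_
  filter_upwards [h1] with ω h3
  rw [h3]

end WienerLaw

/-! ### Gaussian law of the observations in the two models -/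

section Observation

open Matrix

variable {n : ℕ}

lemma coe_designPoint (n : ℕ) (i : Fin n) : (designPoint n i : ℝ) = ((i : ℕ) + 1 : ℝ) / n := by
  simp [designPoint]

/-- The integral of `ρ` over the cell `(k / n, (k + 1) / n]`. -/
noncomputable def cellIntegral (ρ : ℝ → ℝ) (n : ℕ) (k : Fin n) : ℝ :=
  ∫ x in ((k : ℕ) / n : ℝ)..(((k : ℕ) + 1 : ℕ) / n : ℝ), ρ x

lemma sum_cellIntegral {ρ : ℝ → ℝ} (hρ : Continuous ρ) (i : Fin n) :
    (∑ k : Fin n, if k ≤ i then cellIntegral ρ n k else 0)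
      = ∫ x in Ioc (0 : ℝ) (designPoint n i), ρ x := by
  rw [← intervalIntegral.integral_of_le (by positivity), coe_designPoint]
  have h1 := intervalIntegral.sum_integral_adjacent_intervals (μ := volume) (f := ρ)
    (a := fun k : ℕ => (k / n : ℝ)) (n := i + 1) fun k _ => hρ.intervalIntegrable _ _
  simp only [Nat.cast_zero, zero_div] at h1
  push_cast at h1
  rw [← h1]
  have h2 : ∀ k : Fin n, (if k ≤ i then cellIntegral ρ n k else 0)
      = (fun k : ℕ => if k < (i : ℕ) + 1 then
          ∫ x in (k / n : ℝ)..(((k : ℝ) + 1) / n), ρ x else 0) k := fun k => by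
    simp only [Fin.le_def, Nat.lt_succ_iff, cellIntegral]
    push_cast
    rfl
  rw [Finset.sum_congr rfl fun k _ => h2 k,
    Fin.sum_univ_eq_sum_range (fun k : ℕ => if k < (i : ℕ) + 1 then
      ∫ x in (k / n : ℝ)..(((k : ℝ) + 1) / n), ρ x else 0) n, ← Finset.sum_filter]
  congr 1
  ext k
  simp only [Finset.mem_filter, Finset.mem_range]
  have := i.2
  omega

/-- The kernel `D_i 𝟙_{(0, i/n]} √ρ` of the `i`-th signal variable. -/
noncomputable def signalKernel (D : Fin n → ℝ) (ρ : ℝ → ℝ) (i : Fin n) : ℝ → ℝ :=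
  fun x => D i * (Ioc (0 : ℝ) (designPoint n i)).indicator (fun s => √(ρ s)) x

lemma memLp_signalKernel (D : Fin n → ℝ) {ρ : ℝ → ℝ} (hρ : Continuous ρ) (i : Fin n) :
    MemLp (signalKernel D ρ i) 2 (volume.restrict (Ioi (0 : ℝ))) := by
  refine MemLp.const_mul ?_ (D i)
  refine MemLp.restrict _ ?_
  rw [memLp_indicator_iff_restrict measurableSet_Ioc]
  have h1 : Continuous fun s => √(ρ s) := by fun_prop
  obtain ⟨C, hC⟩ := (isCompact_Icc (a := (0 : ℝ)) (b := designPoint n i)).exists_bound_of_continuousOn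
    h1.continuousOn
  refine MemLp.of_bound h1.aestronglyMeasurable C ?_
  filter_upwards [ae_restrict_mem measurableSet_Ioc] with x hx
  exact hC x ⟨hx.1.le, hx.2⟩

/-- The product of two kernels lives on (0, min(i, j)/n], and its integral is the sum of the cell
integrals up to that index, which is an entry of S diag(d) Sᵀ. -/
lemma integral_signalKernel_mul (D : Fin n → ℝ) {ρ : ℝ → ℝ} (hρ : Continuous ρ)
    (h0 : ∀ x, 0 ≤ ρ x) (i j : Fin n) :
    ∫ x in Ioi (0 : ℝ), signalKernel D ρ i x * signalKernel D ρ j x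
      = (diagonal D * partialSumMatrix n * diagonal (cellIntegral ρ n)
          * (diagonal D * partialSumMatrix n)ᵀ) i j := by
  have h1 : ∀ x, signalKernel D ρ i x * signalKernel D ρ j x
      = D i * D j * (Ioc (0 : ℝ) (designPoint n (min i j))).indicator ρ x := by
    intro x
    have hmin : (designPoint n (min i j) : ℝ) = min (designPoint n i : ℝ) (designPoint n j) := by
      have hmono : Monotone fun i : Fin n => (designPoint n i : ℝ) := fun i j hij => by
        simp only [coe_designPoint]
        have : ((i : ℕ) : ℝ) ≤ (j : ℕ) := by exact_mod_cast hij
        gcongr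
      exact hmono.map_min
    have h2 : x ∈ Ioc (0 : ℝ) (designPoint n (min i j))
        ↔ x ∈ Ioc (0 : ℝ) (designPoint n i) ∧ x ∈ Ioc (0 : ℝ) (designPoint n j) := by
      rw [hmin]
      simp only [mem_Ioc, le_min_iff]
      tauto
    simp only [signalKernel, indicator_apply, h2]
    by_cases hi : x ∈ Ioc (0 : ℝ) (designPoint n i) <;>
      by_cases hj : x ∈ Ioc (0 : ℝ) (designPoint n j) <;> simp only [hi, hj, and_self, and_true,
        true_and, if_true, if_false, mul_zero, zero_mul]
    have := Real.mul_self_sqrt (h0 x)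
    linear_combination (D i * D j) * this
  simp_rw [h1]
  rw [integral_const_mul, setIntegral_indicator measurableSet_Ioc,
    inter_eq_right.2 (fun x hx => hx.1), ← sum_cellIntegral hρ]
  rw [Matrix.mul_assoc (diagonal D), Matrix.mul_assoc, transpose_mul, diagonal_transpose,
    diagonal_mul, ← Matrix.mul_assoc, mul_diagonal, mul_apply]
  simp only [mul_diagonal, transpose_apply, partialSumMatrix, of_apply, Finset.mul_sum,
    Finset.sum_mul]
  refine Finset.sum_congr rfl fun k _ => ?_
  simp only [le_min_iff]
  split_ifs <;> first | (exfalso; tauto) | ring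

variable {Ω : Type*} [MeasurableSpace Ω] {W : ℝ≥0 → Ω → ℝ} {P : Measure Ω}

lemma aemeasurable_observation [SFinite P] {X : Fin n → Ω → ℝ} (hX : ∀ i, AEMeasurable (X i) P)
    (τ : ℝ → ℝ) (ν : Measure (Fin n → ℝ)) [SFinite ν] :
    AEMeasurable (observation X τ) (P.prod ν) := by
  refine aemeasurable_pi_lambda _ fun i => ?_
  refine AEMeasurable.add ?_ ?_
  · exact (hX i).comp_fst
  · exact Measurable.aemeasurable (by fun_prop)

/-- The law of the observations with standard Gaussian noise. -/
lemma hasGaussianCharFun_observation (hW : IsPreBrownianReal W P) {X : Fin n → Ω → ℝ}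
    {D : Fin n → ℝ} {ρ : ℝ → ℝ} (hρ : Continuous ρ) (h0 : ∀ x, 0 ≤ ρ x) (τ : ℝ)
    (hX : ∀ i, IsWienerIntegral W P (signalKernel D ρ i) (X i)) :
    HasGaussianCharFun ((P.prod (Measure.pi fun _ : Fin n => gaussianReal 0 1)).map
      (observation X fun _ => τ)) (covMatrix D (cellIntegral ρ n) τ) := by
  have := hW.isGaussianProcess.isProbabilityMeasure
  intro a
  have hm : Measurable fun y : Fin n → ℝ => Complex.exp (((a ⬝ᵥ y : ℝ) : ℂ) * Complex.I) := by
    unfold dotProduct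
    fun_prop
  rw [integral_map (aemeasurable_observation (fun i => (hX i).1.aestronglyMeasurable.aemeasurable)
    _ _) hm.aestronglyMeasurable]
  have h1 : ∀ p : Ω × (Fin n → ℝ),
      Complex.exp (((a ⬝ᵥ observation X (fun _ => τ) p : ℝ) : ℂ) * Complex.I)
      = Complex.exp (((∑ i, a i * X i p.1 : ℝ) : ℂ) * Complex.I)
        * Complex.exp ((((fun i => τ * a i) ⬝ᵥ p.2 : ℝ) : ℂ) * Complex.I) := by
    intro p
    rw [← Complex.exp_add, ← add_mul, ← Complex.ofReal_add]
    congr 3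
    simp only [dotProduct, observation]
    rw [← Finset.sum_add_distrib]
    exact Finset.sum_congr rfl fun i _ => by ring
  simp_rw [h1]
  rw [integral_prod_mul (fun ω => Complex.exp (((∑ i, a i * X i ω : ℝ) : ℂ) * Complex.I))
    (fun e : Fin n → ℝ => Complex.exp ((((fun i => τ * a i) ⬝ᵥ e : ℝ) : ℂ) * Complex.I)),
    IsWienerIntegral.integral_exp_sum hW (fun i => memLp_signalKernel D hρ i) hX,
    hasGaussianCharFun_pi (fun _ => 1) (fun i => τ * a i), ← Complex.exp_add]
  congr 1
  simp_rw [integral_signalKernel_mul D hρ h0]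
  rw [covMatrix, add_mulVec, dotProduct_add]
  have h2 : ∀ M : Matrix (Fin n) (Fin n) ℝ, ∑ i, ∑ j, a i * a j * M i j = a ⬝ᵥ (M *ᵥ a) := by
    intro M
    simp only [dotProduct, mulVec, Finset.mul_sum]
    exact Finset.sum_congr rfl fun i _ => Finset.sum_congr rfl fun j _ => by ring
  have h3 : (fun i => τ * a i) ⬝ᵥ (diagonal (fun i : Fin n => ((1 : ℝ≥0) : ℝ))
      *ᵥ fun i => τ * a i) = a ⬝ᵥ ((τ ^ 2 • (1 : Matrix (Fin n) (Fin n) ℝ)) *ᵥ a) := by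
    rw [smul_mulVec, one_mulVec, dotProduct_smul]
    simp only [dotProduct, mulVec_diagonal, NNReal.coe_one, one_mul, smul_eq_mul, Finset.mul_sum]
    exact Finset.sum_congr rfl fun i _ => by ring
  rw [h2, h3]
  push_cast
  ring

lemma isWienerIntegral_signalTime (hW : IsPreBrownianReal W P) {ρ : ℝ → ℝ} (hρ : Continuous ρ)
    (i : Fin n) :
    IsWienerIntegral W P (signalKernel (fun _ => 1) ρ i) (signalTime W P ρ n i) := by
  have h1 : signalKernel (fun _ => 1) ρ i
      = (Ioc (0 : ℝ) (designPoint n i)).indicator fun s => √(ρ s) := by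
    ext x; simp [signalKernel]
  have h2 := exists_isWienerIntegral hW (memLp_signalKernel (fun _ => 1) hρ i)
  rw [h1] at *
  rw [signalTime, wienerIntegral, dif_pos h2]
  exact h2.choose_spec

/-- Here the multiplier σ(i/n) is constant in the integration variable, so the kernel is itself a
step function and a constant approximating sequence works. This puts both models into one framework.
-/
lemma isWienerIntegral_signalSpace (hW : IsPreBrownianReal W P) (ρ : ℝ → ℝ) (i : Fin n) :
    IsWienerIntegral W P (signalKernel (fun i => √(ρ (designPoint n i))) (fun _ => 1) i)
      (signalSpace W ρ n i) := by
  refine ⟨(hW.isGaussianProcess.hasGaussianLaw_eval _).memLp_two.const_mul _,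
    fun _ => Finsupp.single (designPoint n i) √(ρ (designPoint n i)), ?_, ?_⟩
  · refine tendsto_const_nhds.congr fun _ => ?_
    rw [eq_comm]
    convert eLpNorm_zero using 2
    ext x
    simp [stepFun, signalKernel]
  · refine tendsto_const_nhds.congr fun _ => ?_
    rw [eq_comm, ← eLpNorm_zero (μ := P) (p := 2) (ε := ℝ)]
    refine eLpNorm_congr_ae ?_
    filter_upwards [hW.eval_zero_ae_eq_zero] with ω hω
    simp [stepIntegral, signalSpace, hω]

end Observation

/-! ### Assouad's lemma -/

section Assouad

lemma exists_measurable_argmin {Y B : Type*} [MeasurableSpace Y] [MeasurableSpace B] [Fintype B]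
    [Nonempty B] {L : B → Y → ℝ≥0∞} (hL : ∀ b, Measurable (L b)) :
    ∃ g : Y → B, Measurable g ∧ ∀ b y, L (g y) y ≤ L b y := by
  classical
  have key : ∀ s : Finset B, s.Nonempty → ∃ g : Y → B, Measurable g ∧
      Measurable (fun y => L (g y) y) ∧ ∀ b ∈ s, ∀ y, L (g y) y ≤ L b y := by
    intro s hs
    induction hs using Finset.Nonempty.cons_induction with
    | singleton a =>
      exact ⟨fun _ => a, measurable_const, hL a, fun b hb y => by rw [Finset.mem_singleton.1 hb]⟩
    | cons a s ha hs ih =>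
      obtain ⟨g, hg, hgL, hmin⟩ := ih
      have hset : MeasurableSet {y | L a y ≤ L (g y) y} := measurableSet_le (hL a) hgL
      refine ⟨fun y => if L a y ≤ L (g y) y then a else g y,
        Measurable.ite hset measurable_const hg, ?_, fun b hb y => ?_⟩
      · have : (fun y => L (if L a y ≤ L (g y) y then a else g y) y)
            = fun y => if L a y ≤ L (g y) y then L a y else L (g y) y := by
          ext y; split_ifs <;> rfl
        rw [this]
        exact Measurable.ite hset (hL a) hgL
      · dsimp only
        rcases Finset.mem_cons.1 hb with rfl | hb
        · split_ifs with h
          exacts [le_rfl, (not_le.1 h).le]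
        · split_ifs with h
          exacts [h.trans (hmin b hb y), hmin b hb y]
  obtain ⟨g, hg, -, hmin⟩ := key Finset.univ Finset.univ_nonempty
  exact ⟨g, hg, fun b y => hmin b (Finset.mem_univ b) y⟩

/-- With p = μ S and q = ν S, p + 1 - q ≥ q²/2 + 1 - q = 1/2 + (1 - q)²/2. -/
lemma half_le_measure_add_compl {Y : Type*} [MeasurableSpace Y] {μ ν : Measure Y}
    [IsProbabilityMeasure ν] {S : Set Y} (hS : MeasurableSet S)
    (h : ν S ^ 2 ≤ 2 * μ S) : 2⁻¹ ≤ μ S + ν Sᶜ := by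
  by_cases hμ : μ S = ∞
  · simp [hμ]
  rw [prob_compl_eq_one_sub hS]
  obtain ⟨p, hp⟩ : ∃ p : ℝ≥0, (p : ℝ≥0∞) = μ S := ⟨_, ENNReal.coe_toNNReal hμ⟩
  obtain ⟨q, hq⟩ : ∃ q : ℝ≥0, (q : ℝ≥0∞) = ν S := ⟨_, ENNReal.coe_toNNReal (measure_ne_top ν S)⟩
  have hq1 : q ≤ 1 := by
    have := prob_le_one (μ := ν) (s := S)
    rw [← hq] at this
    exact_mod_cast this
  rw [← hp, ← hq] at h ⊢
  have h' : q ^ 2 ≤ 2 * p := by exact_mod_cast h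
  have : (2⁻¹ : ℝ≥0) ≤ p + (1 - q) := by
    rw [← NNReal.coe_le_coe]
    push_cast [NNReal.coe_sub hq1]
    have h2 : (q : ℝ) ^ 2 ≤ 2 * p := by exact_mod_cast h'
    nlinarith [sq_nonneg ((q : ℝ) - 1)]
  have h3 : ((2⁻¹ : ℝ≥0) : ℝ≥0∞) ≤ ((p + (1 - q) : ℝ≥0) : ℝ≥0∞) := by exact_mod_cast this
  simpa using h3

variable {ι : Type*} [DecidableEq ι]

/-- Change the `k`-th bit of `b`. -/
def flipBit (k : ι) (b : ι → Bool) : ι → Bool := Function.update b k (!b k)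

lemma flipBit_involutive (k : ι) : Function.Involutive (flipBit k) := by
  intro b
  simp [flipBit]

variable [Fintype ι]

/-- The testing form of Assouad's lemma. -/
lemma assouad_sum_le {Y : Type*} [MeasurableSpace Y] (μ : (ι → Bool) → Measure Y)
    [∀ b, IsProbabilityMeasure (μ b)]
    (hμ : ∀ b k, ∀ S, MeasurableSet S → μ (flipBit k b) S ^ 2 ≤ 2 * μ b S)
    {g : Y → ι → Bool} (hg : Measurable g) :
    (Fintype.card (ι → Bool) : ℝ≥0∞) * (Fintype.card ι / 4)
      ≤ ∑ b, ∑ k, μ b {y | g y k ≠ b k} := by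
  have hmeas : ∀ k (c : Bool), MeasurableSet {y | g y k ≠ c} := fun k c =>
    ((measurable_pi_apply k).comp hg (measurableSet_singleton c)).compl
  rw [Finset.sum_comm]
  have h1 : ∀ k, (Fintype.card (ι → Bool) : ℝ≥0∞) * 4⁻¹ ≤ ∑ b, μ b {y | g y k ≠ b k} := by
    intro k
    -- Flipping bit k permutes the cube, so the total error can be counted twice, once at b and once
    -- at its neighbour. Each pair of neighbours then contributes a testing error of at least 1/2.
    have h2 : ∑ b, μ (flipBit k b) {y | g y k ≠ flipBit k b k} = ∑ b, μ b {y | g y k ≠ b k} :=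
      Equiv.sum_comp (flipBit_involutive k).toPerm fun b => μ b {y | g y k ≠ b k}
    have h3 : ∀ b, 2⁻¹ ≤ μ b {y | g y k ≠ b k} + μ (flipBit k b) {y | g y k ≠ flipBit k b k} := by
      intro b
      have : {y | g y k ≠ flipBit k b k} = {y | g y k ≠ b k}ᶜ := by
        ext y
        simp only [flipBit, Function.update_self, mem_ofPred_eq, mem_compl_iff, not_not]
        cases g y k <;> cases b k <;> simp
      rw [this]
      exact half_le_measure_add_compl (hmeas k _) (hμ b k _ (hmeas k _))
    have h4 : (Fintype.card (ι → Bool) : ℝ≥0∞) * 2⁻¹ ≤ 2 * ∑ b, μ b {y | g y k ≠ b k} := by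
      rw [two_mul]
      nth_rewrite 2 [← h2]
      rw [← Finset.sum_add_distrib]
      refine le_trans (le_of_eq ?_) (Finset.sum_le_sum fun b _ => h3 b)
      rw [Finset.sum_const, nsmul_eq_mul]
      rfl
    have h5 := mul_le_mul_right h4 (2⁻¹ : ℝ≥0∞)
    rw [← mul_assoc 2⁻¹ 2, ENNReal.inv_mul_cancel (by norm_num) (by norm_num), one_mul] at h5
    refine le_trans (le_of_eq ?_) h5
    rw [mul_left_comm, ← ENNReal.mul_inv (by norm_num) (by norm_num)]
    norm_num
  refine le_trans (le_of_eq ?_) (Finset.sum_le_sum fun k _ => h1 k)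
  rw [Finset.sum_const, nsmul_eq_mul, Finset.card_univ, div_eq_mul_inv, mul_left_comm]

lemma enorm_sub_sq_le (x y z : ℝ) : ‖x - y‖ₑ ^ 2 ≤ 2 * ‖z - x‖ₑ ^ 2 + 2 * ‖z - y‖ₑ ^ 2 := by
  have h1 : ∀ w : ℝ, ‖w‖ₑ ^ 2 = ENNReal.ofReal (w ^ 2) := fun w => by
    rw [Real.enorm_eq_ofReal_abs, ← ENNReal.ofReal_pow (abs_nonneg w), sq_abs]
  have h2 : (2 : ℝ≥0∞) = ENNReal.ofReal 2 := by simp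
  rw [h1, h1, h1, h2, ← ENNReal.ofReal_mul (by norm_num), ← ENNReal.ofReal_mul (by norm_num),
    ← ENNReal.ofReal_add (by positivity) (by positivity)]
  exact ENNReal.ofReal_le_ofReal (by nlinarith [sq_nonneg (z - x + (z - y))])

/-- **Assouad's lemma** for the integrated squared error. -/
theorem assouad {Y : Type*} [MeasurableSpace Y] (μ : (ι → Bool) → Measure Y)
    [∀ b, IsProbabilityMeasure (μ b)]
    (hμ : ∀ b k, ∀ S, MeasurableSet S → μ (flipBit k b) S ^ 2 ≤ 2 * μ b S)
    {f : (ι → Bool) → ℝ → ℝ} (hf : ∀ b, Measurable (f b)) {δ : ℝ≥0∞}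
    (hδ : ∀ b b', δ * ∑ k, (if b k ≠ b' k then 1 else 0)
      ≤ ∫⁻ t in Icc (0 : ℝ) 1, ‖f b t - f b' t‖ₑ ^ 2)
    {T : Y → ℝ → ℝ} (hT : Measurable (Function.uncurry T)) :
    δ * (Fintype.card ι / 16)
      ≤ ⨆ b, ∫⁻ y, (∫⁻ t in Icc (0 : ℝ) 1, ‖T y t - f b t‖ₑ ^ 2) ∂(μ b) := by
  set L : (ι → Bool) → Y → ℝ≥0∞ := fun b y => ∫⁻ t in Icc (0 : ℝ) 1, ‖T y t - f b t‖ₑ ^ 2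
    with hLdef
  have hint : ∀ b, Measurable fun p : Y × ℝ => ‖T p.1 p.2 - f b p.2‖ₑ ^ 2 := fun b =>
    ((hT.sub ((hf b).comp measurable_snd)).enorm).pow_const 2
  have hL : ∀ b, Measurable (L b) := fun b => (hint b).lintegral_prod_right'
  obtain ⟨g, hg, hmin⟩ := exists_measurable_argmin hL
  have hmeas : ∀ k (c : Bool), MeasurableSet {y | g y k ≠ c} := fun k c =>
    ((measurable_pi_apply k).comp hg (measurableSet_singleton c)).compl
  -- Replacing the estimator by a nearest vertex costs a factor 4: twice its own loss plus twice the
  -- loss at b, and the former does not exceed the latter. Together with the factor 1/4 in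
  -- `assouad_sum_le` this gives 1/16.
  have hloss : ∀ b y, δ * ∑ k, (if g y k ≠ b k then 1 else 0) ≤ 4 * L b y := by
    intro b y
    have hm1 : ∀ b, Measurable fun t => 2 * ‖T y t - f b t‖ₑ ^ 2 := fun b =>
      ((hint b).comp measurable_prodMk_left).const_mul 2
    calc δ * ∑ k, (if g y k ≠ b k then 1 else 0)
        ≤ ∫⁻ t in Icc (0 : ℝ) 1, ‖f (g y) t - f b t‖ₑ ^ 2 := hδ _ _
      _ ≤ ∫⁻ t in Icc (0 : ℝ) 1, (2 * ‖T y t - f (g y) t‖ₑ ^ 2 + 2 * ‖T y t - f b t‖ₑ ^ 2) :=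
          lintegral_mono fun t => enorm_sub_sq_le _ _ _
      _ = 2 * L (g y) y + 2 * L b y := by
          rw [lintegral_add_left (hm1 _), lintegral_const_mul' _ _ (by norm_num),
            lintegral_const_mul' _ _ (by norm_num)]
      _ ≤ 2 * L b y + 2 * L b y := by gcongr; exact hmin b y
      _ = 4 * L b y := by rw [← add_mul]; norm_num
  have hrisk : ∀ b, δ * ∑ k, μ b {y | g y k ≠ b k} ≤ 4 * ⨆ b, ∫⁻ y, L b y ∂(μ b) := by
    intro b
    have h1 : δ * ∑ k, μ b {y | g y k ≠ b k}
        = ∫⁻ y, δ * ∑ k, (if g y k ≠ b k then 1 else 0) ∂(μ b) := by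
      have hm2 : ∀ k, Measurable fun y => (if g y k ≠ b k then (1 : ℝ≥0∞) else 0) := fun k =>
        Measurable.ite (hmeas k _) measurable_const measurable_const
      rw [lintegral_const_mul _ (Finset.measurable_sum _ fun k _ => hm2 k),
        lintegral_finsetSum _ fun k _ => hm2 k]
      congr 1
      refine Finset.sum_congr rfl fun k _ => ?_
      rw [← lintegral_indicator_one (hmeas k _)]
      exact lintegral_congr fun y => by simp [indicator_apply]
    rw [h1]
    refine (lintegral_mono (hloss b)).trans ?_
    rw [lintegral_const_mul _ (hL b)]
    gcongr
    exact le_iSup (fun b => ∫⁻ y, L b y ∂(μ b)) b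
  set R := ⨆ b, ∫⁻ y, L b y ∂(μ b)
  have hsum : (Fintype.card (ι → Bool) : ℝ≥0∞) * (δ * (Fintype.card ι / 4))
      ≤ Fintype.card (ι → Bool) * (4 * R) := by
    rw [mul_left_comm]
    refine (mul_le_mul_right (assouad_sum_le μ hμ hg) δ).trans ?_
    rw [Finset.mul_sum]
    refine (Finset.sum_le_sum fun b _ => hrisk b).trans (le_of_eq ?_)
    rw [Finset.sum_const, nsmul_eq_mul]
    rfl
  rw [ENNReal.mul_le_mul_iff_right (by simp) (by simp)] at hsum
  have h5 := mul_le_mul_right hsum (4⁻¹ : ℝ≥0∞)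
  rw [← mul_assoc 4⁻¹ 4, ENNReal.inv_mul_cancel (by norm_num) (by norm_num), one_mul] at h5
  refine le_trans (le_of_eq ?_) h5
  rw [mul_left_comm, div_eq_mul_inv, div_eq_mul_inv, mul_left_comm 4⁻¹,
    ← ENNReal.mul_inv (by norm_num) (by norm_num)]
  norm_num

end Assouad

/-! ### The hypercube of cosine perturbations -/

section CosineFamily

lemma integral_cos_int_mul_pi {k : ℤ} (hk : k ≠ 0) :
    ∫ x in (0 : ℝ)..1, Real.cos ((k : ℝ) * Real.pi * x) = 0 := by
  have h : (k : ℝ) * Real.pi ≠ 0 := mul_ne_zero (by exact_mod_cast hk) Real.pi_ne_zero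
  rw [intervalIntegral.integral_comp_mul_left (fun x => Real.cos x) h, integral_cos]
  simp [Real.sin_int_mul_pi]

lemma integral_cos_mul_cos (p q : ℕ) :
    ∫ x in (0 : ℝ)..1, Real.cos (((p + 1 : ℕ) : ℝ) * Real.pi * x)
      * Real.cos (((q + 1 : ℕ) : ℝ) * Real.pi * x) = if p = q then 1 / 2 else 0 := by
  have h1 : ∀ x, Real.cos (((p + 1 : ℕ) : ℝ) * Real.pi * x)
      * Real.cos (((q + 1 : ℕ) : ℝ) * Real.pi * x)
      = 2⁻¹ * (Real.cos ((((p : ℤ) - q : ℤ) : ℝ) * Real.pi * x)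
        + Real.cos ((((p : ℤ) + q + 2 : ℤ) : ℝ) * Real.pi * x)) := by
    intro x
    have e1 : (((p : ℤ) - q : ℤ) : ℝ) * Real.pi * x
        = ((p + 1 : ℕ) : ℝ) * Real.pi * x - ((q + 1 : ℕ) : ℝ) * Real.pi * x := by
      push_cast; ring
    have e2 : (((p : ℤ) + q + 2 : ℤ) : ℝ) * Real.pi * x
        = ((p + 1 : ℕ) : ℝ) * Real.pi * x + ((q + 1 : ℕ) : ℝ) * Real.pi * x := by
      push_cast; ring
    rw [e1, e2, Real.cos_sub, Real.cos_add]
    ring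
  simp_rw [h1]
  have hc : ∀ k : ℤ, IntervalIntegrable (fun x => Real.cos ((k : ℝ) * Real.pi * x)) volume 0 1 :=
    fun k => Continuous.intervalIntegrable (by fun_prop) _ _
  rw [intervalIntegral.integral_const_mul, intervalIntegral.integral_add (hc _) (hc _),
    integral_cos_int_mul_pi (k := (p : ℤ) + q + 2) (by omega)]
  split_ifs with h
  · subst h
    simp
  · rw [integral_cos_int_mul_pi (k := (p : ℤ) - q) (by omega)]
    simp

variable {m : ℕ}

/-- The squared volatility `c + 2 ∑ᵢ γ bᵢ cos (i π x)`. -/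
noncomputable def cosFun (c γ : ℝ) (b : Fin m → Bool) (x : ℝ) : ℝ :=
  c + ∑ i : Fin m, 2 * ((if b i then γ else 0) * Real.cos ((((i : ℕ) + 1 : ℕ) : ℝ) * Real.pi * x))

lemma continuous_cosFun (c γ : ℝ) (b : Fin m → Bool) : Continuous (cosFun c γ b) := by
  unfold cosFun
  fun_prop

lemma abs_cosFun_sub_le {γ : ℝ} (hγ : 0 ≤ γ) (c : ℝ) (b : Fin m → Bool) (x : ℝ) :
    |cosFun c γ b x - c| ≤ 2 * γ * m := by
  rw [cosFun, add_sub_cancel_left]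
  refine (Finset.abs_sum_le_sum_abs _ _).trans ?_
  have : ∀ i : Fin m, |2 * ((if b i then γ else 0)
      * Real.cos ((((i : ℕ) + 1 : ℕ) : ℝ) * Real.pi * x))| ≤ 2 * γ := by
    intro i
    rw [abs_mul, abs_mul, abs_two]
    have h1 := Real.abs_cos_le_one ((((i : ℕ) + 1 : ℕ) : ℝ) * Real.pi * x)
    have h2 : |(if b i then γ else 0)| ≤ γ := by
      split_ifs
      · rw [abs_of_nonneg hγ]
      · simpa using hγ
    nlinarith [abs_nonneg (if b i then γ else 0), mul_le_mul h2 h1 (abs_nonneg _) hγ]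
  refine (Finset.sum_le_sum fun i _ => this i).trans (le_of_eq ?_)
  simp [mul_comm]

lemma cosFun_mem_boundedSobolevSEllipsoid {α : ℕ} {C l u c γ : ℝ} (hγ : 0 ≤ γ)
    (b : Fin m → Bool) (hC : γ ^ 2 * (m : ℝ) ^ (2 * α + 1) ≤ C) (hl : l + 2 * γ * m ≤ c)
    (hu : c + 2 * γ * m ≤ u) : cosFun c γ b ∈ boundedSobolevSEllipsoid α C l u := by
  set θ : ℕ → ℝ := fun j => if j = 0 then c else
    if h : j - 1 < m then (if b ⟨j - 1, h⟩ then γ else 0) else 0 with hθ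
  have hθs : ∀ i : Fin m, θ ((i : ℕ) + 1) = if b i then γ else 0 := fun i => by simp [hθ]
  have hθz : ∀ i, i ∉ Finset.range m → θ (i + 1) = 0 := fun i hi => by
    have : ¬ i < m := by simpa using hi
    simp [hθ, this]
  have hz2 : ∀ i ∉ Finset.range m,
      ((i + 1 : ℕ) : ℝ) ^ (2 * α) * θ (i + 1) ^ 2 = 0 := fun i hi => by simp [hθz i hi]
  refine ⟨⟨?_, θ, fun x _ => ?_, summable_of_ne_finset_zero hz2, ?_⟩, fun x _ => ?_⟩
  · refine MemLp.of_bound (continuous_cosFun c γ b).aestronglyMeasurable (|c| + 2 * γ * m)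
      (Eventually.of_forall fun x => ?_)
    have := abs_cosFun_sub_le hγ c b x
    rw [Real.norm_eq_abs]
    calc |cosFun c γ b x| = |c + (cosFun c γ b x - c)| := by ring_nf
      _ ≤ |c| + |cosFun c γ b x - c| := abs_add_le _ _
      _ ≤ _ := by gcongr
  · have h1 := hasSum_sum_of_ne_finset_zero (L := SummationFilter.unconditional ℕ) (s := Finset.range m)
      (f := fun i : ℕ => 2 * (θ (i + 1) * Real.cos (((i + 1 : ℕ) : ℝ) * Real.pi * x)))
      fun i hi => by simp [hθz i hi]
    convert h1 using 1
    rw [Finset.sum_range, cosFun]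
    have : θ 0 = c := by simp [hθ]
    rw [this, add_sub_cancel_left]
    exact Finset.sum_congr rfl fun i _ => by rw [hθs]
  · rw [tsum_eq_sum hz2]
    have h1 : ∀ i ∈ Finset.range m,
        ((i + 1 : ℕ) : ℝ) ^ (2 * α) * θ (i + 1) ^ 2 ≤ (m : ℝ) ^ (2 * α) * γ ^ 2 := by
      intro i hi
      have him : i < m := by simpa using hi
      have h2 : θ (i + 1) ^ 2 ≤ γ ^ 2 := by
        rw [hθs ⟨i, him⟩]
        split_ifs
        · exact le_rfl
        · simpa using sq_nonneg γ
      have h3 : ((i + 1 : ℕ) : ℝ) ≤ m := by exact_mod_cast him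
      gcongr
    refine (Finset.sum_le_sum h1).trans (le_trans (le_of_eq ?_) hC)
    rw [Finset.sum_const, Finset.card_range, nsmul_eq_mul]
    ring
  · have := abs_le.1 (abs_cosFun_sub_le hγ c b x)
    constructor <;> linarith [this.1, this.2]

/-- The cosines are orthogonal with squared norm 1/2 and each differing bit has coefficient ±2γ,
hence 4γ² · 1/2 per bit. -/
lemma lintegral_cosFun_sub (c γ : ℝ) (b b' : Fin m → Bool) :
    ∫⁻ t in Icc (0 : ℝ) 1, ‖cosFun c γ b t - cosFun c γ b' t‖ₑ ^ 2
      = ENNReal.ofReal (2 * γ ^ 2) * ∑ k, (if b k ≠ b' k then 1 else 0) := by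
  set e : Fin m → ℝ := fun i => 2 * ((if b i then γ else 0) - if b' i then γ else 0) with he
  have h1 : ∀ t, ‖cosFun c γ b t - cosFun c γ b' t‖ₑ ^ 2 = ENNReal.ofReal
      (∑ i, ∑ j, e i * e j * (Real.cos ((((i : ℕ) + 1 : ℕ) : ℝ) * Real.pi * t)
        * Real.cos ((((j : ℕ) + 1 : ℕ) : ℝ) * Real.pi * t))) := by
    intro t
    rw [Real.enorm_eq_ofReal_abs, ← ENNReal.ofReal_pow (abs_nonneg _), sq_abs]
    congr 1
    have h2 : cosFun c γ b t - cosFun c γ b' t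
        = ∑ i, e i * Real.cos ((((i : ℕ) + 1 : ℕ) : ℝ) * Real.pi * t) := by
      rw [cosFun, cosFun, add_sub_add_left_eq_sub, ← Finset.sum_sub_distrib]
      exact Finset.sum_congr rfl fun i _ => by simp only [he]; ring
    rw [h2, sq, Finset.sum_mul_sum]
    exact Finset.sum_congr rfl fun i _ => Finset.sum_congr rfl fun j _ => by ring
  have hc : ∀ i j : Fin m, Continuous fun t => e i * e j *
      (Real.cos ((((i : ℕ) + 1 : ℕ) : ℝ) * Real.pi * t)
        * Real.cos ((((j : ℕ) + 1 : ℕ) : ℝ) * Real.pi * t)) := fun i j => by fun_prop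
  have hcont : Continuous fun t => ∑ i, ∑ j, e i * e j *
      (Real.cos ((((i : ℕ) + 1 : ℕ) : ℝ) * Real.pi * t)
        * Real.cos ((((j : ℕ) + 1 : ℕ) : ℝ) * Real.pi * t)) :=
    continuous_finsetSum _ fun i _ => continuous_finsetSum _ fun j _ => hc i j
  have hpos : ∀ t, 0 ≤ ∑ i, ∑ j, e i * e j *
      (Real.cos ((((i : ℕ) + 1 : ℕ) : ℝ) * Real.pi * t)
        * Real.cos ((((j : ℕ) + 1 : ℕ) : ℝ) * Real.pi * t)) := by
    intro t
    have : ∑ i, ∑ j, e i * e j * (Real.cos ((((i : ℕ) + 1 : ℕ) : ℝ) * Real.pi * t)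
        * Real.cos ((((j : ℕ) + 1 : ℕ) : ℝ) * Real.pi * t))
        = (∑ i, e i * Real.cos ((((i : ℕ) + 1 : ℕ) : ℝ) * Real.pi * t)) ^ 2 := by
      rw [sq, Finset.sum_mul_sum]
      exact Finset.sum_congr rfl fun i _ => Finset.sum_congr rfl fun j _ => by ring
    rw [this]
    positivity
  simp_rw [h1]
  rw [← ofReal_integral_eq_lintegral_ofReal (hcont.continuousOn.integrableOn_compact isCompact_Icc)
    (Eventually.of_forall hpos), integral_Icc_eq_integral_Ioc,
    ← intervalIntegral.integral_of_le zero_le_one,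
    intervalIntegral.integral_finsetSum fun i _ => (continuous_finsetSum _ fun j _ =>
      hc i j).intervalIntegrable _ _]
  have h3 : ∀ i : Fin m, ∫ t in (0 : ℝ)..1, ∑ j, e i * e j *
      (Real.cos ((((i : ℕ) + 1 : ℕ) : ℝ) * Real.pi * t)
        * Real.cos ((((j : ℕ) + 1 : ℕ) : ℝ) * Real.pi * t))
      = 2 * γ ^ 2 * if b i ≠ b' i then 1 else 0 := by
    intro i
    rw [intervalIntegral.integral_finsetSum fun j _ => (hc i j).intervalIntegrable _ _]
    simp_rw [intervalIntegral.integral_const_mul, integral_cos_mul_cos, Fin.val_inj]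
    simp only [mul_ite, mul_zero, Finset.sum_ite_eq, Finset.mem_univ, if_true, he]
    cases b i <;> cases b' i <;> simp <;> ring
  simp_rw [h3]
  rw [← Finset.mul_sum, ENNReal.ofReal_mul (by positivity)]
  congr 1
  rw [ENNReal.ofReal_sum_of_nonneg fun i _ => by split_ifs <;> norm_num]
  exact Finset.sum_congr rfl fun i _ => by split_ifs <;> simp

lemma cosFun_flipBit_sub (c γ : ℝ) (b : Fin m → Bool) (k : Fin m) :
    ∃ s : ℝ, |s| = 1 ∧ ∀ x, cosFun c γ (flipBit k b) x - cosFun c γ b x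
      = s * (2 * γ * Real.cos ((((k : ℕ) + 1 : ℕ) : ℝ) * Real.pi * x)) := by
  refine ⟨if b k then -1 else 1, by split_ifs <;> simp, fun x => ?_⟩
  rw [cosFun, cosFun, add_sub_add_left_eq_sub, ← Finset.sum_sub_distrib,
    Finset.sum_eq_single k _ (by simp)]
  · simp only [flipBit, Function.update_self]
    cases b k <;> simp <;> ring
  · intro i _ hi
    simp [flipBit, Function.update_of_ne hi]

lemma abs_cosFun_flipBit_sub_le {γ : ℝ} (hγ : 0 ≤ γ) (c : ℝ) (b : Fin m → Bool) (k : Fin m)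
    (x : ℝ) : |cosFun c γ (flipBit k b) x - cosFun c γ b x| ≤ 2 * γ := by
  obtain ⟨s, hs, h⟩ := cosFun_flipBit_sub c γ b k
  rw [h, abs_mul, hs, one_mul, abs_mul, abs_of_nonneg (by positivity : 0 ≤ 2 * γ)]
  exact mul_le_of_le_one_right (by positivity) (Real.abs_cos_le_one _)

lemma abs_cos_sub_cos_le {i : ℕ} (hi : i < m) (x y : ℝ) :
    |Real.cos (((i + 1 : ℕ) : ℝ) * Real.pi * x) - Real.cos (((i + 1 : ℕ) : ℝ) * Real.pi * y)|
      ≤ m * Real.pi * |x - y| := by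
  have h1 : ((i + 1 : ℕ) : ℝ) ≤ m := by exact_mod_cast hi
  refine (Real.abs_cos_sub_cos_le _ _).trans ?_
  rw [← mul_sub, abs_mul, abs_of_nonneg (by positivity)]
  gcongr

lemma abs_cosFun_flipBit_sub_sub_le {γ : ℝ} (hγ : 0 ≤ γ) (c : ℝ) (b : Fin m → Bool) (k : Fin m)
    (x y : ℝ) :
    |(cosFun c γ (flipBit k b) x - cosFun c γ b x) - (cosFun c γ (flipBit k b) y - cosFun c γ b y)|
      ≤ 2 * γ * (m * Real.pi * |x - y|) := by
  obtain ⟨s, hs, h⟩ := cosFun_flipBit_sub c γ b k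
  rw [h, h, ← mul_sub, ← mul_sub, abs_mul, abs_mul, hs, one_mul,
    abs_of_nonneg (by positivity : 0 ≤ 2 * γ)]
  gcongr
  exact abs_cos_sub_cos_le k.2 x y

lemma abs_cosFun_sub_cosFun_le {γ : ℝ} (hγ : 0 ≤ γ) (c : ℝ) (b : Fin m → Bool) (x y : ℝ) :
    |cosFun c γ b x - cosFun c γ b y| ≤ 2 * γ * m * (m * Real.pi * |x - y|) := by
  rw [cosFun, cosFun, add_sub_add_left_eq_sub, ← Finset.sum_sub_distrib]
  refine (Finset.abs_sum_le_sum_abs _ _).trans ?_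
  have : ∀ i ∈ (Finset.univ : Finset (Fin m)), |2 * ((if b i then γ else 0)
      * Real.cos ((((i : ℕ) + 1 : ℕ) : ℝ) * Real.pi * x)) - 2 * ((if b i then γ else 0)
      * Real.cos ((((i : ℕ) + 1 : ℕ) : ℝ) * Real.pi * y))| ≤ 2 * γ * (m * Real.pi * |x - y|) := by
    intro i _
    rw [← mul_sub, ← mul_sub, abs_mul, abs_mul, abs_two, mul_assoc 2 γ]
    have h2 : |(if b i then γ else 0)| ≤ γ := by
      split_ifs
      · rw [abs_of_nonneg hγ]
      · simpa using hγ
    have h3 := abs_cos_sub_cos_le i.2 x y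
    gcongr
  refine (Finset.sum_le_sum this).trans (le_of_eq ?_)
  simp only [Finset.sum_const, Finset.card_univ, Fintype.card_fin, nsmul_eq_mul]
  ring

end CosineFamily

/-! ### Perturbation of the covariance matrix in variances and in multipliers -/

section Perturbation

open Matrix

variable {n : ℕ}

/-- The strictly lower triangular matrix with the increments of `r` in its rows. -/
def incrementMatrix (n : ℕ) (r : ℕ → ℝ) : Matrix (Fin n) (Fin n) ℝ :=
  Matrix.of fun k j => if j < k then r k - r (k - 1) else 0

lemma sum_Ioc_increment (r : ℕ → ℝ) {j i : ℕ} (h : j ≤ i) :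
    ∑ k ∈ Finset.Ioc j i, (r k - r (k - 1)) = r i - r j := by
  induction i, h using Nat.le_induction with
  | base => simp
  | succ i h ih =>
    rw [Finset.sum_Ioc_succ_top (by omega), ih]
    simp

/-- Summation by parts: multiplication by `r` and partial sums commute up to increments. -/
lemma diagonal_mul_partialSumMatrix (r : ℕ → ℝ) :
    diagonal (fun i : Fin n => r i) * partialSumMatrix n
      = partialSumMatrix n * (diagonal (fun i : Fin n => r i) + incrementMatrix n r) := by
  ext i j
  rw [diagonal_mul, Matrix.mul_add, Matrix.add_apply, mul_diagonal, mul_apply]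
  have h1 : ∑ k : Fin n, partialSumMatrix n i k * incrementMatrix n r k j
      = ∑ k ∈ Finset.Ioc (j : ℕ) i, (r k - r (k - 1)) := by
    have h2 : ∀ k : Fin n, partialSumMatrix n i k * incrementMatrix n r k j
        = (fun k : ℕ => if (j : ℕ) < k ∧ k ≤ i then r k - r (k - 1) else 0) k := by
      intro k
      simp only [partialSumMatrix, incrementMatrix, of_apply, Fin.le_def, Fin.lt_def]
      split_ifs <;> first | (exfalso; omega) | simp
    rw [Finset.sum_congr rfl fun k _ => h2 k, Fin.sum_univ_eq_sum_range
      (fun k : ℕ => if (j : ℕ) < k ∧ k ≤ i then r k - r (k - 1) else 0) n, ← Finset.sum_filter]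
    congr 1
    ext k
    simp only [Finset.mem_filter, Finset.mem_range, Finset.mem_Ioc]
    have := i.2
    omega
  rw [h1]
  simp only [partialSumMatrix, of_apply]
  split_ifs with h
  · rw [sum_Ioc_increment r h]
    ring
  · rw [Finset.Ioc_eq_empty_of_le (Fin.le_def.1 (not_le.1 h).le)]
    simp

/-- The off-diagonal error when the multiplier of the partial sums is perturbed. -/
noncomputable def multiplierError (n : ℕ) (r : ℕ → ℝ) : Matrix (Fin n) (Fin n) ℝ :=
  incrementMatrix n r + (incrementMatrix n r)ᵀ
    + diagonal (fun i : Fin n => r i) * (incrementMatrix n r)ᵀ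
    + incrementMatrix n r * diagonal (fun i : Fin n => r i)
    + incrementMatrix n r * (incrementMatrix n r)ᵀ

/-- With R = diag r, summation by parts gives R S = S(R + N), N being the increment matrix. Hence
the new multiplier turns U into U(1 + R + N), and the difference is read off from (1 + R + N)(1 + R
+ Nᵀ) - 1. The products of R alone form the diagonal part, all terms containing N the error. -/
lemma covMatrix_mul_sub (D : Fin n → ℝ) (r : ℕ → ℝ) (κ t : ℝ) :
    covMatrix (fun i => D i * (1 + r i)) (fun _ => κ) t - covMatrix D (fun _ => κ) t
      = diagonal D * partialSumMatrix n * (diagonal (fun i : Fin n => κ * (2 * r i + r i ^ 2))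
        + κ • multiplierError n r) * (diagonal D * partialSumMatrix n)ᵀ := by
  set R := diagonal (fun i : Fin n => r i) with hR
  set N := incrementMatrix n r with hN
  set S := partialSumMatrix n with hS
  have hRS : R * S = S * (R + N) := diagonal_mul_partialSumMatrix r
  have h1 : diagonal (fun i : Fin n => D i * (1 + r i)) * S
      = diagonal D * S * (1 + (R + N)) := by
    have : diagonal (fun i : Fin n => D i * (1 + r i)) = diagonal D * (1 + R) := by
      rw [hR, ← diagonal_one, diagonal_add, diagonal_mul_diagonal]
    rw [this, Matrix.mul_assoc, Matrix.mul_assoc, Matrix.add_mul, hRS]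
    simp only [Matrix.mul_add, Matrix.mul_one, Matrix.one_mul]
  have h2 : diagonal (fun i : Fin n => κ * (2 * r i + r i ^ 2)) = κ • (R + R + R * R) := by
    rw [hR, diagonal_mul_diagonal, diagonal_add, diagonal_add, ← diagonal_smul]
    congr 1
    ext i
    simp only [Pi.smul_apply, smul_eq_mul]
    ring
  have h3 : diagonal (fun _ : Fin n => κ) = κ • (1 : Matrix (Fin n) (Fin n) ℝ) :=
    (smul_one_eq_diagonal κ).symm
  have hRt : Rᵀ = R := diagonal_transpose _
  rw [covMatrix, covMatrix, h1, h2, h3, multiplierError, ← hN, ← hR, add_sub_add_right_eq_sub]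
  set U := diagonal D * S with hU
  clear_value U R N
  rw [transpose_mul, transpose_add, transpose_add, transpose_one, hRt]
  simp only [Matrix.mul_add, Matrix.add_mul, Matrix.mul_one, Matrix.one_mul, Matrix.mul_smul,
    Matrix.smul_mul, smul_add, Matrix.mul_assoc]
  abel

lemma sum_multiplierError_sq_le {r : ℕ → ℝ} {ω : ℝ} (hω : ω ≤ 1) (hr : ∀ i, |r i| ≤ 1)
    (hr' : ∀ i, |r (i + 1) - r i| ≤ ω / n) :
    ∑ j, ∑ i, multiplierError n r i j ^ 2 ≤ 25 * ω ^ 2 := by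
  rcases Nat.eq_zero_or_pos n with rfl | hn
  · simpa using sq_nonneg ω
  have hn' : (0 : ℝ) < n := by exact_mod_cast hn
  have hωn : 0 ≤ ω / n := (abs_nonneg _).trans (hr' 0)
  have hω0 : 0 ≤ ω := by
    have := mul_nonneg hωn hn'.le
    rwa [div_mul_cancel₀ _ hn'.ne'] at this
  have hN : ∀ k j, |incrementMatrix n r k j| ≤ ω / n := by
    intro k j
    simp only [incrementMatrix, of_apply]
    split_ifs with h
    · have := hr' (k - 1)
      have h2 : (k : ℕ) - 1 + 1 = k := by
        have := Fin.lt_def.1 h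
        omega
      rwa [h2] at this
    · simpa using hωn
  -- Five summands, each entrywise at most ω/n. For N Nᵀ the n terms of size (ω/n)² sum to ω²/n, and
  -- ω ≤ 1 is used.
  have hentry : ∀ i j, |multiplierError n r i j| ≤ 5 * (ω / n) := by
    intro i j
    simp only [multiplierError, Matrix.add_apply, transpose_apply, diagonal_mul, mul_diagonal]
    have e1 := hN i j
    have e2 := hN j i
    have e3 : |r i * incrementMatrix n r j i| ≤ ω / n := by
      rw [abs_mul]
      exact (mul_le_of_le_one_left (abs_nonneg _) (hr i)).trans e2
    have e4 : |incrementMatrix n r i j * r j| ≤ ω / n := by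
      rw [abs_mul]
      exact (mul_le_of_le_one_right (abs_nonneg _) (hr j)).trans e1
    have e5 : |(incrementMatrix n r * (incrementMatrix n r)ᵀ) i j| ≤ ω / n := by
      rw [mul_apply]
      refine (Finset.abs_sum_le_sum_abs _ _).trans ?_
      have : ∀ k ∈ (Finset.univ : Finset (Fin n)),
          |incrementMatrix n r i k * (incrementMatrix n r)ᵀ k j| ≤ ω / n * (ω / n) := by
        intro k _
        rw [abs_mul, transpose_apply]
        exact mul_le_mul (hN i k) (hN j k) (abs_nonneg _) hωn
      refine (Finset.sum_le_sum this).trans ?_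
      rw [Finset.sum_const, Finset.card_univ, Fintype.card_fin, nsmul_eq_mul, ← mul_assoc,
        mul_div_cancel₀ _ hn'.ne']
      exact mul_le_of_le_one_left hωn hω
    refine (abs_add_le _ _).trans ?_
    have f1 := abs_add_le (incrementMatrix n r i j + incrementMatrix n r j i
      + r i * incrementMatrix n r j i) (incrementMatrix n r i j * r j)
    have f2 := abs_add_le (incrementMatrix n r i j + incrementMatrix n r j i)
      (r i * incrementMatrix n r j i)
    have f3 := abs_add_le (incrementMatrix n r i j) (incrementMatrix n r j i)
    linarith
  have hsq : ∀ j ∈ (Finset.univ : Finset (Fin n)), ∀ i ∈ (Finset.univ : Finset (Fin n)),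
      multiplierError n r i j ^ 2 ≤ (5 * (ω / n)) ^ 2 :=
    fun j _ i _ => sq_le_sq.2 ((hentry i j).trans (le_abs_self _))
  refine (Finset.sum_le_sum fun j hj => Finset.sum_le_sum (hsq j hj)).trans (le_of_eq ?_)
  simp only [Finset.sum_const, Finset.card_univ, Fintype.card_fin, nsmul_eq_mul]
  field_simp
  ring

/-- Perturbing the variances of the increments. -/
lemma trace_covMatrix_sub_le_of_variance {d₀ d₁ : Fin n → ℝ} {D : Fin n → ℝ} {a b t η : ℝ}
    (ha : 0 < a) (hb : 0 < b) (ht : 0 < t) (hd : ∀ i, a ^ 2 ≤ d₀ i)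
    (hD : ∀ i, b ^ 2 * D i ^ 2 ≤ t ^ 2) (hη : 0 ≤ η) (h : ∀ i, (d₁ i - d₀ i) ^ 2 ≤ η) :
    ((covMatrix D d₀ t)⁻¹ * (covMatrix D d₁ t - covMatrix D d₀ t)
      * ((covMatrix D d₀ t)⁻¹ * (covMatrix D d₁ t - covMatrix D d₀ t))).trace
      ≤ 2 * η * (n / (a ^ 3 * b)) := by
  have := trace_perturbation_le ha hb ht hd hD (fun i => d₁ i - d₀ i) 0 hη h (e := 0) (by simp)
    (B := covMatrix D d₁ t - covMatrix D d₀ t) (by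
      rw [add_zero, covMatrix, covMatrix, add_sub_add_right_eq_sub, ← Matrix.sub_mul,
        ← Matrix.mul_sub, ← diagonal_sub])
  simpa using this

/-- Perturbing the multiplier of the partial sums. -/
lemma trace_covMatrix_sub_le_of_multiplier {D : Fin n → ℝ} {r : ℕ → ℝ} {b t ρ ω : ℝ}
    (hn : 0 < n) (hb : 0 < b) (ht : 0 < t) (hD : ∀ i, b ^ 2 * D i ^ 2 ≤ t ^ 2) (hρ : ρ ≤ 1)
    (hω : ω ≤ 1) (hr : ∀ i, |r i| ≤ ρ) (hr' : ∀ i, |r (i + 1) - r i| ≤ ω / n)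
    {A₁ : Matrix (Fin n) (Fin n) ℝ}
    (hA₁ : A₁ = covMatrix (fun i => D i * (1 + r i)) (fun _ => (1 / n : ℝ)) t) :
    ((covMatrix D (fun _ => (1 / n : ℝ)) t)⁻¹ * (A₁ - covMatrix D (fun _ => (1 / n : ℝ)) t)
      * ((covMatrix D (fun _ => (1 / n : ℝ)) t)⁻¹
        * (A₁ - covMatrix D (fun _ => (1 / n : ℝ)) t))).trace
      ≤ 18 * (ρ ^ 2 * √n) / b + 50 * ω ^ 2 := by
  have hn' : (0 : ℝ) < n := by exact_mod_cast hn
  have hs : 0 < √(n : ℝ) := Real.sqrt_pos.2 hn'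
  have hs2 : √(n : ℝ) ^ 2 = n := Real.sq_sqrt hn'.le
  have hρ0 : 0 ≤ ρ := (abs_nonneg _).trans (hr 0)
  -- As |r| ≤ ρ ≤ 1, the diagonal entries (2r + r²)/n are at most 3ρ/n, whence η = 9ρ²/n². The error
  -- matrix carries the factor 1/n, which cancels against a⁻⁴ = n² and leaves 50ω².
  have h1 := trace_perturbation_le (D := D) (d := fun _ => (1 / n : ℝ)) (a := 1 / √n) (b := b)
    (by positivity) hb ht
    (fun i => by rw [div_pow, one_pow, hs2]) hD
    (fun i : Fin n => (1 / n : ℝ) * (2 * r i + r i ^ 2)) ((1 / n : ℝ) • multiplierError n r)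
    (η := 9 * ρ ^ 2 / n ^ 2) (e := 25 * ω ^ 2 / n ^ 2) (by positivity) (fun i => by
      rw [mul_pow, div_pow, one_pow, one_div_mul_eq_div]
      have h2 := abs_le.1 (hr i)
      have h3 : |2 * r i + r i ^ 2| ≤ 3 * ρ := by
        rw [abs_le]
        constructor <;> nlinarith
      have h4 : (2 * r i + r i ^ 2) ^ 2 ≤ (3 * ρ) ^ 2 := sq_le_sq.2 (h3.trans (le_abs_self _))
      gcongr
      linarith) (by
      have h2 := sum_multiplierError_sq_le (n := n) hω (fun i => (hr i).trans hρ) hr'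
      simp only [Matrix.smul_apply, smul_eq_mul, mul_pow, ← Finset.mul_sum]
      rw [div_pow, one_pow, one_div_mul_eq_div]
      gcongr)
    (B := A₁ - covMatrix D (fun _ => (1 / n : ℝ)) t) (by rw [hA₁]; exact covMatrix_mul_sub D r _ t)
  refine h1.trans (le_of_eq ?_)
  have h5 : (n : ℝ) = √n ^ 2 := hs2.symm
  set s := √(n : ℝ)
  rw [h5]
  field_simp
  ring

end Perturbation

/-! ### Stability of square roots of ratios -/

section SqrtRatio

lemma abs_sqrt_sub_sqrt_le {κ p q : ℝ} (hκ : 0 < κ) (hp : κ ≤ p) (hq : 0 ≤ q) :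
    |√p - √q| ≤ |p - q| / √κ := by
  have h1 : 0 < √κ := Real.sqrt_pos.2 hκ
  have h2 : √κ ≤ √p := Real.sqrt_le_sqrt hp
  have h3 : |p - q| = |√p - √q| * (√p + √q) := by
    rw [← abs_of_nonneg (by positivity : 0 ≤ √p + √q), ← abs_mul]
    congr 1
    nlinarith [Real.mul_self_sqrt (hκ.le.trans hp), Real.mul_self_sqrt hq]
  rw [le_div_iff₀ h1, h3]
  exact mul_le_mul_of_nonneg_left (by linarith [Real.sqrt_nonneg q]) (abs_nonneg _)

lemma abs_sqrt_div_sub_one_le {l x y ε : ℝ} (hl : 0 < l) (hx : l ≤ x) (hy : 0 ≤ y)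
    (h : |y - x| ≤ ε) : |√(y / x) - 1| ≤ ε / l := by
  have hx0 : 0 < x := hl.trans_le hx
  have h1 := abs_sqrt_sub_sqrt_le one_pos le_rfl (div_nonneg hy hx0.le)
  rw [Real.sqrt_one, div_one, abs_sub_comm, abs_sub_comm 1] at h1
  refine h1.trans ?_
  rw [div_sub_one hx0.ne', abs_div, abs_of_pos hx0]
  gcongr
  exact (abs_nonneg _).trans h

lemma abs_sqrt_div_sub_sqrt_div_le {l u x y x' y' ε δ ζ : ℝ} (hl : 0 < l)
    (hx : l ≤ x) (hx' : l ≤ x') (hxu : x ≤ u) (hxu' : x' ≤ u) (hy : l ≤ y) (hy' : l ≤ y')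
    (hε : |y' - x'| ≤ ε) (hδ : |(y - x) - (y' - x')| ≤ δ) (hζ : |x' - x| ≤ ζ) :
    |√(y / x) - √(y' / x')| ≤ (u * δ + ε * ζ) / l ^ 2 / √(l / u) := by
  have hx0 : 0 < x := hl.trans_le hx
  have hx0' : 0 < x' := hl.trans_le hx'
  have hu0 : 0 < u := hx0.trans_le hxu
  have h1 : l / u ≤ y / x := by gcongr; exact hl.le.trans hy
  refine (abs_sqrt_sub_sqrt_le (div_pos hl hu0) h1
    (div_nonneg (hl.le.trans hy') hx0'.le)).trans ?_
  gcongr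
  -- Write y/x - 1 as (y - x)/x: the first term is the increment of the difference y - x, the second
  -- the increment of the denominator weighted by the small difference. Both are small in the
  -- application.
  have h2 : y / x - y' / x' = (((y - x) - (y' - x')) * x' + (y' - x') * (x' - x)) / (x * x') := by
    field_simp
    ring
  have hε0 := (abs_nonneg _).trans hε
  have hδ0 := (abs_nonneg _).trans hδ
  have hζ0 := (abs_nonneg _).trans hζ
  rw [h2, abs_div, abs_of_pos (by positivity : 0 < x * x')]
  refine div_le_div₀ (by positivity) ?_ (by positivity) ?_
  · refine (abs_add_le _ _).trans ?_
    rw [abs_mul, abs_mul, abs_of_pos hx0', mul_comm u δ]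
    gcongr
  · rw [sq]
    gcongr

end SqrtRatio

/-! ### Neighbouring observation laws are hard to distinguish -/

section Closeness

open Matrix

variable {Ω : Type*} [MeasurableSpace Ω] {W : ℝ≥0 → Ω → ℝ} {P : Measure Ω} {n m : ℕ}

/-- The law of the observations with standard Gaussian noise. -/
noncomputable def obsLaw (P : Measure Ω) (X : Fin n → Ω → ℝ) (τ : ℝ) : Measure (Fin n → ℝ) :=
  (P.prod (Measure.pi fun _ : Fin n => gaussianReal 0 1)).map (observation X fun _ => τ)

lemma isProbabilityMeasure_obsLaw [IsProbabilityMeasure P] {X : Fin n → Ω → ℝ}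
    (hX : ∀ i, AEMeasurable (X i) P) (τ : ℝ) : IsProbabilityMeasure (obsLaw P X τ) :=
  Measure.isProbabilityMeasure_map (aemeasurable_observation hX _ _)

lemma cellIntegral_sub_le {ρ₀ ρ₁ : ℝ → ℝ} (h₀ : Continuous ρ₀) (h₁ : Continuous ρ₁) {ε : ℝ}
    (h : ∀ x, |ρ₁ x - ρ₀ x| ≤ ε) (k : Fin n) :
    |cellIntegral ρ₁ n k - cellIntegral ρ₀ n k| ≤ ε / n := by
  rw [cellIntegral, cellIntegral, ← intervalIntegral.integral_sub (h₁.intervalIntegrable _ _)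
    (h₀.intervalIntegrable _ _), ← Real.norm_eq_abs]
  refine (intervalIntegral.norm_integral_le_of_norm_le_const fun x _ => h x).trans (le_of_eq ?_)
  rw [← sub_div, Nat.cast_add_one, add_sub_cancel_left, abs_of_nonneg (by positivity),
    mul_one_div]

lemma le_cellIntegral {ρ : ℝ → ℝ} (hρ : Continuous ρ) {l : ℝ} (h : ∀ x, l ≤ ρ x) (k : Fin n) :
    l / n ≤ cellIntegral ρ n k := by
  have h1 : ((k : ℕ) / n : ℝ) ≤ (((k : ℕ) + 1 : ℕ) / n : ℝ) := by
    push_cast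
    gcongr
    linarith
  have h2 := intervalIntegral.integral_mono_on (μ := volume) (f := fun _ => l) h1
    (continuous_const.intervalIntegrable _ _)
    (hρ.intervalIntegrable _ _) fun x _ => h x
  rw [intervalIntegral.integral_const, ← sub_div, Nat.cast_add_one, add_sub_cancel_left,
    smul_eq_mul, one_div_mul_eq_div] at h2
  rw [cellIntegral, Nat.cast_add_one]
  exact h2

lemma cellIntegral_one (n : ℕ) : cellIntegral (fun _ => 1) n = fun _ => (1 / n : ℝ) := by
  ext k
  rw [cellIntegral, intervalIntegral.integral_const, ← sub_div, Nat.cast_add_one,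
    add_sub_cancel_left, smul_eq_mul, mul_one]

lemma obsLaw_sq_le [IsProbabilityMeasure P] (hW : IsPreBrownianReal W P) {X₀ X₁ : Fin n → Ω → ℝ}
    {D₀ D₁ : Fin n → ℝ} {ρ₀ ρ₁ : ℝ → ℝ} (hρ₀ : Continuous ρ₀) (hρ₁ : Continuous ρ₁)
    (h₀ : ∀ x, 0 ≤ ρ₀ x) (h₁ : ∀ x, 0 ≤ ρ₁ x) {τ : ℝ} (hτ : 0 < τ)
    (hX₀ : ∀ i, IsWienerIntegral W P (signalKernel D₀ ρ₀ i) (X₀ i))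
    (hX₁ : ∀ i, IsWienerIntegral W P (signalKernel D₁ ρ₁ i) (X₁ i))
    {A₀ A₁ : Matrix (Fin n) (Fin n) ℝ} (hA₀ : A₀ = covMatrix D₀ (cellIntegral ρ₀ n) τ)
    (hA₁ : A₁ = covMatrix D₁ (cellIntegral ρ₁ n) τ)
    (htr : (A₀⁻¹ * (A₁ - A₀) * (A₀⁻¹ * (A₁ - A₀))).trace ≤ 3 / 4)
    {S : Set (Fin n → ℝ)} (hS : MeasurableSet S) :
    obsLaw P X₁ τ S ^ 2 ≤ 2 * obsLaw P X₀ τ S := by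
  have := isProbabilityMeasure_obsLaw (fun i => (hX₀ i).1.aestronglyMeasurable.aemeasurable) τ
  have := isProbabilityMeasure_obsLaw (fun i => (hX₁ i).1.aestronglyMeasurable.aemeasurable) τ
  have hp : ∀ {D : Fin n → ℝ} {ρ : ℝ → ℝ}, Continuous ρ → (∀ x, 0 ≤ ρ x) →
      (covMatrix D (cellIntegral ρ n) τ).PosDef := fun hρ h => covMatrix_posDef
    (fun i => by simpa using le_cellIntegral hρ h i) hτ
  have hp₀ : A₀.PosDef := hA₀ ▸ hp hρ₀ h₀
  have hp₁ : A₁.PosDef := hA₁ ▸ hp hρ₁ h₁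
  have hg₀ : HasGaussianCharFun (obsLaw P X₀ τ) A₀ :=
    hA₀ ▸ hasGaussianCharFun_observation hW hρ₀ h₀ τ hX₀
  have hg₁ : HasGaussianCharFun (obsLaw P X₁ τ) (A₀ + (A₁ - A₀)) := by
    rw [add_sub_cancel]
    exact hA₁ ▸ hasGaussianCharFun_observation hW hρ₁ h₁ τ hX₁
  exact hg₀.sq_le hp₀ (hp₁.isHermitian.sub hp₀.isHermitian) hg₁ htr hS

/-- The cell integrals are at least l/n and change by at most 2γ/n. Taking a = √(l/n), b = τ₀ and η
= (2γ/n)² makes the trace bound equal to 8γ²√n/(l^{3/2} τ₀), uniformly in τ ≥ τ₀. -/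
lemma obsLaw_signalTime_sq_le [IsProbabilityMeasure P] (hW : IsPreBrownianReal W P)
    {ρ₀ ρ₁ : ℝ → ℝ} (hρ₀ : Continuous ρ₀) (hρ₁ : Continuous ρ₁) {l γ τ τ₀ : ℝ} (hn : 0 < n)
    (hl : 0 < l) (hτ₀ : 0 < τ₀) (hτ : τ₀ ≤ τ) (h₀ : ∀ x, l ≤ ρ₀ x) (h₁ : ∀ x, l ≤ ρ₁ x)
    (hγ : ∀ x, |ρ₁ x - ρ₀ x| ≤ 2 * γ) (hsmall : 8 * (γ ^ 2 * √n) / (√l ^ 3 * τ₀) ≤ 3 / 4)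
    {S : Set (Fin n → ℝ)} (hS : MeasurableSet S) :
    obsLaw P (signalTime W P ρ₁ n) τ S ^ 2 ≤ 2 * obsLaw P (signalTime W P ρ₀ n) τ S := by
  have hn' : (0 : ℝ) < n := by exact_mod_cast hn
  have hs : 0 < √(n : ℝ) := Real.sqrt_pos.2 hn'
  have hs2 : √(n : ℝ) ^ 2 = n := Real.sq_sqrt hn'.le
  have hl2 : √l ^ 2 = l := Real.sq_sqrt hl.le
  have hl3 : 0 < √l := Real.sqrt_pos.2 hl
  refine obsLaw_sq_le hW hρ₀ hρ₁ (fun x => hl.le.trans (h₀ x)) (fun x => hl.le.trans (h₁ x))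
    (hτ₀.trans_le hτ) (isWienerIntegral_signalTime hW hρ₀) (isWienerIntegral_signalTime hW hρ₁)
    rfl rfl ?_ hS
  refine (trace_covMatrix_sub_le_of_variance (a := √l / √n) (b := τ₀) (η := (2 * γ / n) ^ 2)
    (by positivity) hτ₀ (hτ₀.trans_le hτ) (fun i => ?_) (fun i => ?_) (by positivity)
    fun i => ?_).trans (le_trans (le_of_eq ?_) hsmall)
  · rw [div_pow, hl2, hs2]
    exact le_cellIntegral hρ₀ h₀ i
  · rw [one_pow, mul_one]
    gcongr
  · exact sq_le_sq.2 ((cellIntegral_sub_le hρ₀ hρ₁ hγ i).trans (le_abs_self _))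
  · have h5 : (n : ℝ) = √n ^ 2 := hs2.symm
    set s := √(n : ℝ)
    rw [h5]
    field_simp
    ring

lemma obsLaw_signalSpace_sq_le [IsProbabilityMeasure P] (hW : IsPreBrownianReal W P)
    {ρ₀ ρ₁ : ℝ → ℝ} {l u γ τ τ₀ ω : ℝ} (hn : 0 < n)
    (hl : 0 < l) (hτ₀ : 0 < τ₀) (hτ : τ₀ ≤ τ) (h₀ : ∀ x, l ≤ ρ₀ x) (h₁ : ∀ x, l ≤ ρ₁ x)
    (hu : ∀ x, ρ₀ x ≤ u) (hr : 2 * γ / l ≤ 1) (hω : ω ≤ 1)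
    (hγ : ∀ x, |ρ₁ x - ρ₀ x| ≤ 2 * γ)
    (hinc : ∀ x y : ℝ, |x - y| = (1 / n : ℝ) → |√(ρ₁ x / ρ₀ x) - √(ρ₁ y / ρ₀ y)| ≤ ω / n)
    (hsmall : 18 * ((2 * γ / l) ^ 2 * √n) / (τ₀ / √u) + 50 * ω ^ 2 ≤ 3 / 4)
    {S : Set (Fin n → ℝ)} (hS : MeasurableSet S) :
    obsLaw P (signalSpace W ρ₁ n) τ S ^ 2 ≤ 2 * obsLaw P (signalSpace W ρ₀ n) τ S := by
  have hn' : (0 : ℝ) < n := by exact_mod_cast hn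
  have hu0 : 0 < u := hl.trans_le ((h₀ 0).trans (hu 0))
  have hu1 : 0 < √u := Real.sqrt_pos.2 hu0
  have hu2 : √u ^ 2 = u := Real.sq_sqrt hu0.le
  refine obsLaw_sq_le hW continuous_const continuous_const (fun _ => zero_le_one)
    (fun _ => zero_le_one) (hτ₀.trans_le hτ) (isWienerIntegral_signalSpace hW ρ₀)
    (isWienerIntegral_signalSpace hW ρ₁) rfl rfl ?_ hS
  rw [cellIntegral_one]
  -- The relative change of σ at the design point (i + 1)/n is r i = √(ρ₁/ρ₀) - 1, and b = τ₀/√u is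
  -- admissible because D² ≤ u.
  refine (trace_covMatrix_sub_le_of_multiplier (b := τ₀ / √u) (ρ := 2 * γ / l) (ω := ω)
    (r := fun i => √(ρ₁ ((i + 1 : ℝ) / n) / ρ₀ ((i + 1 : ℝ) / n)) - 1) hn (by positivity)
    (hτ₀.trans_le hτ) (fun i => ?_) hr hω (fun i => ?_) (fun i => ?_) ?_).trans hsmall
  · rw [div_pow, hu2, Real.sq_sqrt (hl.le.trans (h₀ _)), div_mul_eq_mul_div, div_le_iff₀ hu0]
    have h3 := hu (designPoint n i)
    have h4 := hl.le.trans (h₀ (designPoint n i))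
    gcongr
  · exact abs_sqrt_div_sub_one_le hl (h₀ _) (hl.le.trans (h₁ _)) (hγ _)
  · rw [sub_sub_sub_cancel_right]
    refine hinc _ _ ?_
    rw [← sub_div]
    push_cast
    rw [add_sub_add_right_eq_sub, add_sub_cancel_left, abs_of_nonneg (by positivity)]
  · congr 1
    ext i
    have := Real.sqrt_pos.2 (hl.trans_le (h₀ (((i : ℕ) + 1 : ℝ) / n)))
    rw [coe_designPoint, add_sub_cancel, Real.sqrt_div (hl.le.trans (h₁ _)),
      mul_div_cancel₀ _ this.ne']

end Closeness

/-! ### From Assouad's lemma to the minimax risk -/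

section Risk

variable {Ω : Type*} [MeasurableSpace Ω] {P : Measure Ω} {n m : ℕ}

lemma le_minimaxRisk [IsProbabilityMeasure P] {α : ℕ} {X : (ℝ → ℝ) → Fin n → Ω → ℝ} {τ c γ : ℝ}
    {Θ : Set (ℝ → ℝ)} {𝓛 : Set (Measure ℝ)} (h𝓛 : gaussianReal 0 1 ∈ 𝓛)
    (hΘ : ∀ b : Fin m → Bool, cosFun c γ b ∈ Θ)
    (hX : ∀ (b : Fin m → Bool) i, AEMeasurable (X (cosFun c γ b) i) P)
    (hclose : ∀ (b : Fin m → Bool) k, ∀ S, MeasurableSet S →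
      obsLaw P (X (cosFun c γ (flipBit k b))) τ S ^ 2 ≤ 2 * obsLaw P (X (cosFun c γ b)) τ S) :
    ENNReal.ofReal ((n : ℝ) ^ ((α : ℝ) / (2 * (α : ℝ) + 1)) * (γ ^ 2 * m / 8))
      ≤ minimaxRisk P α n X (fun _ => τ) Θ 𝓛 := by
  refine le_iInf₂ fun T hT => ?_
  have := fun b : Fin m → Bool => isProbabilityMeasure_obsLaw (hX b) τ
  have h1 := assouad (fun b : Fin m → Bool => obsLaw P (X (cosFun c γ b)) τ) hclose
    (fun b => (continuous_cosFun c γ b).measurable)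
    (fun b b' => (lintegral_cosFun_sub c γ b b').ge) hT
  have h2 : ENNReal.ofReal (γ ^ 2 * m / 8)
      = ENNReal.ofReal (2 * γ ^ 2) * (Fintype.card (Fin m) / 16) := by
    rw [Fintype.card_fin, ← ENNReal.ofReal_natCast m,
      show (16 : ℝ≥0∞) = ENNReal.ofReal 16 by simp, ← ENNReal.ofReal_div_of_pos (by norm_num),
      ← ENNReal.ofReal_mul (by positivity)]
    congr 1
    ring
  rw [ENNReal.ofReal_mul (by positivity), h2]
  refine (mul_le_mul_right h1 _).trans ?_
  rw [ENNReal.mul_iSup]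
  refine iSup_le fun b => ?_
  refine le_trans (le_of_eq ?_) (le_iSup₂_of_le (cosFun c γ b) (hΘ b)
    (le_iSup₂_of_le (gaussianReal 0 1) h𝓛 le_rfl))
  have hm : Measurable fun y => ∫⁻ t in Icc (0 : ℝ) 1, ‖T y t - cosFun c γ b t‖ₑ ^ 2 :=
    (((hT.sub ((continuous_cosFun c γ b).measurable.comp measurable_snd)).enorm).pow_const
      2).lintegral_prod_right'
  rw [mise, obsLaw, lintegral_map' hm.aemeasurable (aemeasurable_observation (hX b) _ _)]

end Risk

/-! ### Choice of the cutoff frequency and of the amplitude -/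

section Parameters

/-- The number of perturbed frequencies is of order `n ^ (1 / (2 (2 α + 1)))`. -/
lemma exists_frequency_cutoff (α : ℕ) {n : ℕ} (hn : 0 < n) :
    ∃ m : ℕ, 1 ≤ m ∧ √(n : ℝ) ≤ (m : ℝ) ^ (2 * α + 1) ∧
      (m : ℝ) ^ (2 * α) ≤ 4 ^ α * (n : ℝ) ^ ((α : ℝ) / (2 * (α : ℝ) + 1)) := by
  have hn1 : (1 : ℝ) ≤ n := by exact_mod_cast hn
  set x : ℝ := (n : ℝ) ^ (1 / (2 * (2 * (α : ℝ) + 1))) with hx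
  have hx1 : 1 ≤ x := Real.one_le_rpow hn1 (by positivity)
  -- Rounding x up gives the lower bound on m; since x ≥ 1 the rounded value is at most 2x, which
  -- costs the factor 2^{2α} = 4^α.
  refine ⟨⌈x⌉₊, Nat.one_le_ceil_iff.2 (by linarith), ?_, ?_⟩
  · have h1 : x ^ (2 * α + 1) = √(n : ℝ) := by
      rw [hx, ← Real.rpow_natCast, ← Real.rpow_mul (by positivity), Real.sqrt_eq_rpow]
      congr 1
      push_cast
      field_simp
    rw [← h1]
    exact pow_le_pow_left₀ (by linarith) (Nat.le_ceil x) _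
  · have h1 : x ^ (2 * α) = (n : ℝ) ^ ((α : ℝ) / (2 * (α : ℝ) + 1)) := by
      rw [hx, ← Real.rpow_natCast, ← Real.rpow_mul (by positivity)]
      congr 1
      push_cast
      field_simp
    have h2 : (⌈x⌉₊ : ℝ) ≤ 2 * x := by
      have := Nat.ceil_lt_add_one (by linarith : 0 ≤ x)
      linarith
    rw [← h1, show (4 : ℝ) ^ α = 2 ^ (2 * α) by rw [pow_mul]; norm_num, ← mul_pow]
    gcongr

lemma eventually_small {g : ℝ → ℝ} (hg : Continuous g) {c : ℝ} (h : g 0 < c) :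
    ∀ᶠ A in 𝓝[>] (0 : ℝ), g A ≤ c :=
  ((hg.tendsto 0).mono_left nhdsWithin_le_nhds).eventually_le_const h

/-- The Lipschitz constant of the ratio of two neighbouring volatilities. -/
noncomputable def ratioConst (l u : ℝ) : ℝ := 4 * Real.pi * u / l ^ 2 / √(l / u)

/-- All constraints are continuous in A and strict at A = 0, so they hold for every sufficiently
small positive A. None involves n or τ. -/
lemma exists_amplitude {Q l u τ₀ : ℝ} (hQ : 0 < Q) (hlu : l < u) :
    ∃ A : ℝ, 0 < A ∧ A ^ 2 ≤ Q ∧ 2 * A ≤ (u - l) / 2 ∧ 8 * A ^ 2 / (√l ^ 3 * τ₀) ≤ 3 / 4 ∧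
      2 * A / l ≤ 1 ∧ ratioConst l u * A ≤ 1 ∧
      18 * ((2 / l) ^ 2 * A ^ 2) / (τ₀ / √u) + 50 * (ratioConst l u * A) ^ 2 ≤ 3 / 4 := by
  have h : ∀ᶠ A in 𝓝[>] (0 : ℝ), 0 < A ∧ A ^ 2 ≤ Q ∧ 2 * A ≤ (u - l) / 2 ∧
      8 * A ^ 2 / (√l ^ 3 * τ₀) ≤ 3 / 4 ∧ 2 * A / l ≤ 1 ∧ ratioConst l u * A ≤ 1 ∧
      18 * ((2 / l) ^ 2 * A ^ 2) / (τ₀ / √u) + 50 * (ratioConst l u * A) ^ 2 ≤ 3 / 4 := by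
    refine (eventually_mem_nhdsWithin).and (.and ?_ (.and ?_ (.and ?_ (.and ?_ (.and ?_ ?_)))))
    · exact eventually_small (by fun_prop) (by simpa using hQ)
    · exact eventually_small (by fun_prop) (by linarith)
    · exact eventually_small (by fun_prop) (by norm_num)
    · exact eventually_small (by fun_prop) (by norm_num)
    · exact eventually_small (by fun_prop) (by norm_num)
    · exact eventually_small (by fun_prop) (by norm_num)
  exact h.exists

end Parameters

/-! ### The lower bound in the two models -/

section Models

variable {Ω : Type*} [MeasurableSpace Ω] {W : ℝ≥0 → Ω → ℝ} {P : Measure Ω} {n m : ℕ}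

lemma abs_sqrt_cosFun_ratio_sub_le {l u c γ A : ℝ} (hl : 0 < l) (hγ : 0 ≤ γ) (hγm : γ * m ≤ A)
    (hAu : 2 * A ≤ u) (hb : ∀ (b : Fin m → Bool) x, l ≤ cosFun c γ b x ∧ cosFun c γ b x ≤ u)
    (b : Fin m → Bool) (k : Fin m) (x y : ℝ) (hxy : |x - y| = (1 / n : ℝ)) :
    |√(cosFun c γ (flipBit k b) x / cosFun c γ b x)
      - √(cosFun c γ (flipBit k b) y / cosFun c γ b y)| ≤ ratioConst l u * A / n := by
  have hu : 0 < u := hl.trans_le ((hb b 0).1.trans (hb b 0).2)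
  refine (abs_sqrt_div_sub_sqrt_div_le hl (hb b x).1 (hb b y).1 (hb b x).2 (hb b y).2
    (hb _ x).1 (hb _ y).1 (abs_cosFun_flipBit_sub_le hγ c b k y)
    (abs_cosFun_flipBit_sub_sub_le hγ c b k x y)
    (abs_cosFun_sub_cosFun_le hγ c b y x)).trans ?_
  rw [abs_sub_comm y x, hxy]
  -- The bound is (2u + 4γm) γm π/n, and 2γm ≤ 2A ≤ u makes the bracket at most 4u; this is the
  -- source of the 4πu in `ratioConst`.
  have h1 : u * (2 * γ * (m * Real.pi * (1 / n))) + 2 * γ * (2 * γ * m * (m * Real.pi * (1 / n)))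
      ≤ 4 * Real.pi * u * A / n := by
    have e1 : u * (2 * γ * (m * Real.pi * (1 / n)))
        + 2 * γ * (2 * γ * m * (m * Real.pi * (1 / n)))
        = (2 * u + 2 * (2 * (γ * m))) * (γ * m) * (Real.pi / n) := by ring
    have e2 : 4 * Real.pi * u * A / n = (2 * u + 2 * u) * A * (Real.pi / n) := by ring
    rw [e1, e2]
    have h2 : 0 ≤ γ * m := by positivity
    gcongr
    linarith
  calc _ ≤ 4 * Real.pi * u * A / n / l ^ 2 / √(l / u) := by gcongr
    _ = ratioConst l u * A / n := by rw [ratioConst]; ring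

/-- The lower bound for all sample sizes, in both models. -/
theorem le_minimaxRisk_of_amplitude {α : ℕ} (hα : 1 ≤ α) {Q l u τ₀ A : ℝ} (hl : 0 < l)
    (hlu : l < u) (hτ₀ : 0 < τ₀) (hA : 0 < A) (hAQ : A ^ 2 ≤ Q) (hAlu : 2 * A ≤ (u - l) / 2)
    (hA₁ : 8 * A ^ 2 / (√l ^ 3 * τ₀) ≤ 3 / 4) (hAl : 2 * A / l ≤ 1)
    (hAω : ratioConst l u * A ≤ 1)
    (hA₂ : 18 * ((2 / l) ^ 2 * A ^ 2) / (τ₀ / √u) + 50 * (ratioConst l u * A) ^ 2 ≤ 3 / 4)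
    [IsProbabilityMeasure P] (hW : IsPreBrownianReal W P) {τ : ℝ} (hτ : τ₀ ≤ τ)
    {𝓛 : Set (Measure ℝ)} (h𝓛 : gaussianReal 0 1 ∈ 𝓛) (hn : 0 < n) :
    ENNReal.ofReal (A ^ 2 / (8 * 4 ^ α)) ≤ minimaxRisk P α n
        (fun σsq => signalTime W P σsq n) (fun _ => τ) (boundedSobolevSEllipsoid α Q l u) 𝓛 ∧
    ENNReal.ofReal (A ^ 2 / (8 * 4 ^ α)) ≤ minimaxRisk P α n
        (fun σsq => signalSpace W σsq n) (fun _ => τ) (boundedSobolevSEllipsoid α Q l u) 𝓛 := by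
  obtain ⟨m, hm1, hmn, hmr⟩ := exists_frequency_cutoff α hn
  have hm : (1 : ℝ) ≤ m := by exact_mod_cast hm1
  have hm0 : (0 : ℝ) < m := by linarith
  have hn' : (0 : ℝ) < n := by exact_mod_cast hn
  have hu : 0 < u := hl.trans hlu
  -- The largest amplitude compatible with the ellipsoid: γ² m^{2α+1} = A². The cutoff satisfies
  -- m^{2α+1} ≥ √n, so γ²√n ≤ A² as the trace bounds require.
  set γ : ℝ := A / √((m : ℝ) ^ (2 * α + 1)) with hγdef
  have hγ : 0 ≤ γ := by positivity
  have hγ2 : γ ^ 2 = A ^ 2 / (m : ℝ) ^ (2 * α + 1) := by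
    rw [hγdef, div_pow, Real.sq_sqrt (by positivity)]
  have hγn : γ ^ 2 * √n ≤ A ^ 2 := by
    rw [hγ2, div_mul_eq_mul_div, div_le_iff₀ (by positivity)]
    gcongr
  -- After squaring this is m² ≤ m^{2α+1}, the place where α ≥ 1 enters.
  have hγm : γ * m ≤ A := by
    refine le_of_sq_le_sq ?_ hA.le
    rw [mul_pow, hγ2, div_mul_eq_mul_div, div_le_iff₀ (by positivity)]
    gcongr
    omega
  have hγA : γ ≤ A := (le_mul_of_one_le_right hγ hm).trans hγm
  set c := (l + u) / 2 with hc
  have hcl : l + 2 * γ * m ≤ c := by rw [hc]; linarith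
  have hcu : c + 2 * γ * m ≤ u := by rw [hc]; linarith
  have hb : ∀ (b : Fin m → Bool) x, l ≤ cosFun c γ b x ∧ cosFun c γ b x ≤ u := fun b x => by
    have := abs_le.1 (abs_cosFun_sub_le hγ c b x)
    constructor <;> linarith [this.1, this.2]
  have hΘ : ∀ b : Fin m → Bool, cosFun c γ b ∈ boundedSobolevSEllipsoid α Q l u := fun b =>
    cosFun_mem_boundedSobolevSEllipsoid hγ b
      (by rw [hγ2, div_mul_cancel₀ _ (by positivity)]; exact hAQ) hcl hcu
  have hrate : A ^ 2 / (8 * 4 ^ α)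
      ≤ (n : ℝ) ^ ((α : ℝ) / (2 * (α : ℝ) + 1)) * (γ ^ 2 * m / 8) := by
    have e1 : γ ^ 2 * m / 8 = A ^ 2 / (8 * (m : ℝ) ^ (2 * α)) := by
      rw [hγ2]
      field_simp
      ring
    rw [e1, mul_div_assoc', div_le_div_iff₀ (by positivity) (by positivity)]
    calc A ^ 2 * (8 * (m : ℝ) ^ (2 * α))
        ≤ A ^ 2 * (8 * (4 ^ α * (n : ℝ) ^ ((α : ℝ) / (2 * (α : ℝ) + 1)))) := by gcongr
      _ = _ := by ring
  have hflip := fun (b : Fin m → Bool) k x => abs_cosFun_flipBit_sub_le hγ c b k x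
  constructor
  · refine (ENNReal.ofReal_le_ofReal hrate).trans (le_minimaxRisk h𝓛 hΘ (fun b i =>
      (isWienerIntegral_signalTime hW (continuous_cosFun c γ b)
        i).1.aestronglyMeasurable.aemeasurable) fun b k S hS => ?_)
    refine obsLaw_signalTime_sq_le hW (continuous_cosFun c γ b) (continuous_cosFun c γ _) hn hl hτ₀
      hτ (fun x => (hb b x).1) (fun x => (hb _ x).1) (hflip b k) (le_trans ?_ hA₁) hS
    gcongr
  · refine (ENNReal.ofReal_le_ofReal hrate).trans (le_minimaxRisk h𝓛 hΘ (fun b i =>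
      (isWienerIntegral_signalSpace hW (cosFun c γ b)
        i).1.aestronglyMeasurable.aemeasurable) fun b k S hS => ?_)
    refine obsLaw_signalSpace_sq_le (ω := ratioConst l u * A) hW hn hl hτ₀ hτ (fun x => (hb b x).1)
      (fun x => (hb _ x).1) (fun x => (hb b x).2) (le_trans (by gcongr) hAl) hAω (hflip b k)
      (abs_sqrt_cosFun_ratio_sub_le hl hγ hγm (by linarith) hb b k) (le_trans ?_ hA₂) hS
    rw [show (2 * γ / l) ^ 2 * √n = (2 / l) ^ 2 * (γ ^ 2 * √n) by ring]
    gcongr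

end Models

end VolatilityLowerBound

theorem mainTheorem3 (α : ℕ) (hα : 1 ≤ α) (Q l u τ₀ : ℝ) (hQ : 0 < Q) (hl : 0 < l) (hlu : l < u)
    (hτ₀ : 0 < τ₀) :
    ∃ C : ℝ, 0 < C ∧
      ∀ (Ω : Type*) [MeasurableSpace Ω] (P : Measure Ω) [IsProbabilityMeasure P]
        (W : ℝ≥0 → Ω → ℝ), IsBrownianReal W P →
      ∀ τ : ℝ, τ₀ ≤ τ →
      ∀ 𝓛 : Set (Measure ℝ), (∀ ν ∈ 𝓛, VolatilityLowerBound.IsNoiseLaw ν) → gaussianReal 0 1 ∈ 𝓛 →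
        ENNReal.ofReal C ≤ liminf (fun n : ℕ =>
          VolatilityLowerBound.minimaxRisk P α n
            (fun σsq => VolatilityLowerBound.signalTime W P σsq n) (fun _ => τ)
            (VolatilityLowerBound.boundedSobolevSEllipsoid α Q l u) 𝓛) atTop ∧
        ENNReal.ofReal C ≤ liminf (fun n : ℕ =>
          VolatilityLowerBound.minimaxRisk P α n
            (fun σsq => VolatilityLowerBound.signalSpace W σsq n) (fun _ => τ)
            (VolatilityLowerBound.boundedSobolevSEllipsoid α Q l u) 𝓛) atTop := by
  obtain ⟨A, hA, hAQ, hAlu, hA₁, hAl, hAω, hA₂⟩ :=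
    VolatilityLowerBound.exists_amplitude (τ₀ := τ₀) hQ hlu
  refine ⟨A ^ 2 / (8 * 4 ^ α), by positivity, fun Ω _ P _ W hW τ hτ 𝓛 _ h𝓛 => ?_⟩
  -- The bound is nonasymptotic, valid for every n ≥ 1, so the limit inferior needs no further
  -- argument.
  have key := fun (n : ℕ) (hn : 0 < n) => VolatilityLowerBound.le_minimaxRisk_of_amplitude hα hl
    hlu hτ₀ hA hAQ hAlu hA₁ hAl hAω hA₂ hW.toIsPreBrownianReal hτ h𝓛 hn
  constructor
  · exact le_liminf_of_le (by isBoundedDefault)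
      ((eventually_gt_atTop 0).mono fun n hn => (key n hn).1)
  · exact le_liminf_of_le (by isBoundedDefault)
      ((eventually_gt_atTop 0).mono fun n hn => (key n hn).2)
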